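/- Definitions. Let $R$ be an integral domain with quotient field $E$. $R$ is \emph{essential} if it is an intersection of valuation rings that are localizations of $R$, and \emph{locally essential} if $R_p$ is essential for every prime $p$ of $R$. A \emph{valuation overring} of $R$ is a valuation ring $W$ with $R\subseteq W\subseteq E$ and quotient field $E$; $\dim_v(R)$ is the supremum of the Krull dimensions of the valuation overrings of $R$. $R$ is \emph{Jaffard} if $\dim R<\infty$ and $\dim R[T_1,\dots,T_n]=n+\dim R$ for all $n\ge 1$. The $b$-operation is $I^b=\bigcap\{IW: W \text{ a valuation overring of } R\}$. For $t$ transcendental over $E$, the Kronecker function ring is $$\mathrm{Kr}_{E(t)}(R,b)=\Big\{\tfrac{f(t)}{g(t)} : f,g\in R[T],\ g\neq 0,\ c(f)^b\subseteq c(g)^b\Big\},$$ where $c(f)$ is the ideal of $R$ generated by the coefficients of $f$. Construction. Let $r\ge 2$ be an integer, $k_0$ a field, and $X_1,X_2,\dots$, $Z_1,\dots,Z_{r-1}$, $Y$ indeterminates over $k_0$. For $n\ge1$ put $$k_n=k_0(X_1,\dots,X_n),\quad F_n=k_n(Z_1,\dots,Z_{r-1}),\quad K_n=F_n(Y),\quad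 V_n=F_n[Y]_{(Y)},\quad A_n=k_n+YV_n,\quad X_n'=\tfrac{1+YX_n}{Y},$$ $$D_1=A_1,\qquad D_n=\mathrm{Kr}_{K_{n-1}(X_n')}(D_{n-1},b)\cap A_n\quad(n\ge2),\qquad D=\bigcup_{n\ge1}D_n .$$ Statement. For every integer $r\ge2$ and every field $k_0$, the domains $D_n$ form an ascending sequence, and their union $D$ is an essential domain which is not locally essential (some localization of $D$ at a prime is not essential) and which is Jaffard, with $\dim(D)=\dim_v(D)=r$. -/

import Mathlib

noncomputable section

open Polynomial

namespace EssentialDomains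

/-! ### Essential domains, valuative dimension, Jaffard domains -/

section General

variable (R : Type*) [CommRing R] [IsDomain R]

/-- A domain is essential if, inside its quotient field, it is an intersection of valuation rings
that are localizations of it at primes (a localization that is a valuation ring is local, hence is
the localization at a prime). -/
def IsEssential : Prop :=
  ∃ Δ : Set (PrimeSpectrum R),
    (∀ p ∈ Δ, ValuationRing (Localization.AtPrime p.asIdeal)) ∧
    ⨅ p ∈ Δ, Localization.subalgebra.ofField (FractionRing R) p.asIdeal.primeCompl
      p.asIdeal.primeCompl_le_nonZeroDivisors = ⊥

/-- A domain is locally essential if all its localizations at primes are essential. -/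
def IsLocallyEssential : Prop :=
  ∀ p : PrimeSpectrum R, IsEssential (Localization.AtPrime p.asIdeal)

/-- The valuation overrings of `R` in a quotient field `E` of `R`. -/
def valuationOverrings (E : Type*) [Field E] [Algebra R E] : Set (ValuationSubring E) :=
  {W | ∀ a : R, algebraMap R E a ∈ W}

/-- The valuative dimension: the supremum of the Krull dimensions of the valuation overrings. -/
def valuativeDim : WithBot ℕ∞ :=
  ⨆ W ∈ valuationOverrings R (FractionRing R), ringKrullDim W

/-- A Jaffard domain: finite-dimensional, with `dim R[X₁, …, Xₙ] = n + dim R` for all `n ≥ 1`. -/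
def IsJaffard : Prop :=
  ringKrullDim R < ⊤ ∧
    ∀ n : ℕ, 1 ≤ n → ringKrullDim (MvPolynomial (Fin n) R) = n + ringKrullDim R

end General

/-! ### The `b`-operation and the Kronecker function ring -/

section Kronecker

variable (R : Type*) [CommRing R]

/-- The `b`-operation `I ↦ ⋂ IW`, where `W` runs over the valuation overrings of `R` in its quotient
field `E`, for an `R`-submodule `I` of `E`. -/
def bClosure (E : Type*) [Field E] [Algebra R E] (I : Submodule R E) : Submodule R E where
  carrier := {x | ∀ W ∈ valuationOverrings R E, x ∈ Submodule.span W (I : Set E)}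
  zero_mem' := fun _ _ => zero_mem _
  add_mem' := fun hx hy W hW => add_mem (hx W hW) (hy W hW)
  smul_mem' := fun a x hx W hW => by
    have h := (Submodule.span W (I : Set E)).smul_mem ⟨algebraMap R E a, hW a⟩ (hx W hW)
    rw [Algebra.smul_def]
    exact h

/-- The condition `c(f)ᵇ ⊆ c(g)ᵇ` on the content ideals of two polynomials. -/
def ContentLE (E : Type*) [Field E] [Algebra R E] (f g : R[X]) : Prop :=
  bClosure R E (IsLocalization.coeSubmodule E f.contentIdeal) ≤
    bClosure R E (IsLocalization.coeSubmodule E g.contentIdeal)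

variable {R} {E : Type*} [Field E] [Algebra R E]

/-- The structure map from `R` to a valuation overring. -/
def toOverring {W : ValuationSubring E} (hW : W ∈ valuationOverrings R E) : R →+* W :=
  (algebraMap R E).codRestrict W hW

theorem span_content {W : ValuationSubring E} (hW : W ∈ valuationOverrings R E) (f : R[X]) :
    Submodule.span W (IsLocalization.coeSubmodule E f.contentIdeal : Set E) =
      IsLocalization.coeSubmodule E (f.map (toOverring hW)).contentIdeal := by
  rw [contentIdeal_map_eq_map_contentIdeal, Ideal.map, IsLocalization.coeSubmodule_span]
  congr 1
  ext x
  constructor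
  · rintro ⟨a, ha, rfl⟩
    exact ⟨toOverring hW a, ⟨a, ha, rfl⟩, rfl⟩
  · rintro ⟨_, ⟨a, ha, rfl⟩, rfl⟩
    exact ⟨a, ha, rfl⟩

theorem contentLE_iff (f g : R[X]) :
    ContentLE R E f g ↔ ∀ (W : ValuationSubring E) (hW : W ∈ valuationOverrings R E),
      (f.map (toOverring hW)).contentIdeal ≤ (g.map (toOverring hW)).contentIdeal := by
  constructor
  · intro h W hW
    have h1 : Submodule.span W (IsLocalization.coeSubmodule E f.contentIdeal : Set E) ≤
        Submodule.span W (IsLocalization.coeSubmodule E g.contentIdeal : Set E) := by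
      refine Submodule.span_le.2 fun x hx => ?_
      exact h (fun W' _ => Submodule.subset_span hx) W hW
    rw [span_content hW, span_content hW] at h1
    exact (IsLocalization.coeSubmodule_le_coeSubmodule le_rfl).1 h1
  · intro h x hx W hW
    have h1 := hx W hW
    rw [span_content hW] at h1 ⊢
    exact IsLocalization.coeSubmodule_mono E (h W hW) h1

theorem contentIdeal_mul_of_valuationRing {W : Type*} [CommRing W] [IsDomain W] [ValuationRing W]
    (p q : W[X]) : (p * q).contentIdeal = p.contentIdeal * q.contentIdeal := by
  classical
  have hB : ∀ p : W[X], p.contentIdeal.IsPrincipal := fun p =>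
    IsBezout.isPrincipal_of_FG _ p.contentIdeal_FG
  have : IsGCDMonoid W := ⟨IsBezout.toGCDDomain W⟩
  let : NormalizedGCDMonoid W := Classical.choice inferInstance
  simp only [(hB _).contentIdeal_eq_span_content_of_isPrincipal,
    Ideal.span_singleton_mul_span_singleton]
  exact Ideal.span_singleton_eq_span_singleton.2 (associated_content_mul ..)

theorem ContentLE.mul {f₁ g₁ f₂ g₂ : R[X]} (h₁ : ContentLE R E f₁ g₁) (h₂ : ContentLE R E f₂ g₂) :
    ContentLE R E (f₁ * f₂) (g₁ * g₂) := by
  rw [contentLE_iff] at *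
  intro W hW
  simp only [Polynomial.map_mul, contentIdeal_mul_of_valuationRing]
  exact Ideal.mul_mono (h₁ W hW) (h₂ W hW)

theorem ContentLE.add {f₁ f₂ g : R[X]} (h₁ : ContentLE R E f₁ g) (h₂ : ContentLE R E f₂ g) :
    ContentLE R E (f₁ + f₂) g := by
  rw [contentLE_iff] at *
  intro W hW
  rw [contentIdeal_def, Ideal.span_le]
  intro x hx
  obtain ⟨n, -, rfl⟩ := mem_coeffs_iff.1 hx
  rw [Polynomial.map_add, coeff_add]
  exact add_mem (h₁ W hW (coeff_mem_contentIdeal _ n)) (h₂ W hW (coeff_mem_contentIdeal _ n))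

theorem ContentLE.neg {f g : R[X]} (h : ContentLE R E f g) : ContentLE R E (-f) g := by
  rw [contentLE_iff] at *
  intro W hW
  rw [contentIdeal_def, Ideal.span_le]
  intro x hx
  obtain ⟨n, -, rfl⟩ := mem_coeffs_iff.1 hx
  rw [Polynomial.map_neg, coeff_neg]
  exact neg_mem (h W hW (coeff_mem_contentIdeal _ n))

variable (R) [IsDomain R] {L : Type*} [Field L] [Algebra R L]

/-- The Kronecker function ring `Kr(R, b)` of a domain `R` in one indeterminate `t`, where `t` is an
element of a field extension `L` of the quotient field of `R` which is transcendental over `R`: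
the ring of all fractions `f(t) / g(t)` with `f, g ∈ R[X]`, `g(t) ≠ 0` and `c(f)ᵇ ⊆ c(g)ᵇ`, a
subring of `E(t) ⊆ L` for `E` the quotient field of `R`. -/
def kronecker (t : L) : Subring L where
  carrier := {x | ∃ f g : R[X], aeval t g ≠ 0 ∧ ContentLE R (FractionRing R) f g ∧
    x = aeval t f / aeval t g}
  zero_mem' := ⟨0, 1, by simp, by rw [contentLE_iff]; simp, by simp⟩
  one_mem' := ⟨1, 1, by simp, by rw [contentLE_iff]; simp, by simp⟩
  mul_mem' := by
    rintro _ _ ⟨f₁, g₁, h₁, c₁, rfl⟩ ⟨f₂, g₂, h₂, c₂, rfl⟩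
    exact ⟨f₁ * f₂, g₁ * g₂, by simp [h₁, h₂], c₁.mul c₂, by simp [div_mul_div_comm]⟩
  add_mem' := by
    rintro _ _ ⟨f₁, g₁, h₁, c₁, rfl⟩ ⟨f₂, g₂, h₂, c₂, rfl⟩
    refine ⟨f₁ * g₂ + g₁ * f₂, g₁ * g₂, by simp [h₁, h₂],
      (c₁.mul le_rfl).add (ContentLE.mul le_rfl c₂), ?_⟩
    simp [div_add_div _ _ h₁ h₂]
  neg_mem' := by
    rintro _ ⟨f, g, h, c, rfl⟩
    exact ⟨-f, g, h, c.neg, by simp [neg_div]⟩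

end Kronecker

/-! ### The construction

All rings live in one field `L ⊇ k₀` which contains elements `X₀, X₁, …`, `Z₀, …, Z_{m-1}` and `Y`.
The sequences start at the index `0`. -/

section Construction

variable (k₀ : Type*) {L : Type*} [Field k₀] [Field L] [Algebra k₀ L]
  {m : ℕ} (X : ℕ → L) (Z : Fin m → L) (Y : L)

/-- `kₙ = k₀(X₀, …, Xₙ)`. -/
def kField (n : ℕ) : IntermediateField k₀ L :=
  IntermediateField.adjoin k₀ (X '' Set.Iic n)

/-- `Fₙ = kₙ(Z₀, …, Z_{m-1})`. -/
def FField (n : ℕ) : IntermediateField k₀ L :=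
  IntermediateField.adjoin k₀ (X '' Set.Iic n ∪ Set.range Z)

theorem kField_le_FField (n : ℕ) : kField k₀ X n ≤ FField k₀ X Z n :=
  IntermediateField.adjoin.mono _ _ _ Set.subset_union_left

/-- `Vₙ = Fₙ[Y]_(Y)`: the fractions `p(Y) / q(Y)` with `p, q ∈ Fₙ[T]` and `q ∉ (T)`. -/
def VRing (n : ℕ) : Subring L where
  carrier := {x | ∃ p q : (FField k₀ X Z n)[X], q.coeff 0 ≠ 0 ∧ aeval Y q ≠ 0 ∧
    x = aeval Y p / aeval Y q}
  zero_mem' := ⟨0, 1, by simp, by simp, by simp⟩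
  one_mem' := ⟨1, 1, by simp, by simp, by simp⟩
  mul_mem' := by
    rintro _ _ ⟨p₁, q₁, h₁, c₁, rfl⟩ ⟨p₂, q₂, h₂, c₂, rfl⟩
    exact ⟨p₁ * p₂, q₁ * q₂, by simp [mul_coeff_zero, h₁, h₂], by simp [c₁, c₂],
      by simp [div_mul_div_comm]⟩
  add_mem' := by
    rintro _ _ ⟨p₁, q₁, h₁, c₁, rfl⟩ ⟨p₂, q₂, h₂, c₂, rfl⟩
    exact ⟨p₁ * q₂ + q₁ * p₂, q₁ * q₂, by simp [mul_coeff_zero, h₁, h₂], by simp [c₁, c₂],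
      by simp [div_add_div _ _ c₁ c₂]⟩
  neg_mem' := by
    rintro _ ⟨p, q, h, c, rfl⟩
    exact ⟨-p, q, h, c, by simp [neg_div]⟩

theorem kField_le_VRing (n : ℕ) {c : L} (hc : c ∈ kField k₀ X n) : c ∈ VRing k₀ X Z Y n :=
  ⟨C ⟨c, kField_le_FField k₀ X Z n hc⟩, 1, by simp, by simp, by simp [aeval_C]⟩

theorem Y_mem_VRing (n : ℕ) : Y ∈ VRing k₀ X Z Y n :=
  ⟨Polynomial.X, 1, by simp, by simp, by simp⟩

/-- `Aₙ = kₙ + Mₙ`, where `Mₙ = Y Vₙ`. -/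
def ARing (n : ℕ) : Subring L where
  carrier := {x | ∃ c ∈ kField k₀ X n, ∃ v ∈ VRing k₀ X Z Y n, x = c + Y * v}
  zero_mem' := ⟨0, zero_mem _, 0, zero_mem _, by simp⟩
  one_mem' := ⟨1, one_mem _, 0, zero_mem _, by simp⟩
  mul_mem' := by
    rintro _ _ ⟨c, hc, v, hv, rfl⟩ ⟨d, hd, w, hw, rfl⟩
    have hc' := kField_le_VRing k₀ X Z Y n hc
    have hd' := kField_le_VRing k₀ X Z Y n hd
    have hY := Y_mem_VRing k₀ X Z Y n
    exact ⟨c * d, mul_mem hc hd, c * w + d * v + Y * v * w,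
      add_mem (add_mem (mul_mem hc' hw) (mul_mem hd' hv)) (mul_mem (mul_mem hY hv) hw), by ring⟩
  add_mem' := by
    rintro _ _ ⟨c, hc, v, hv, rfl⟩ ⟨d, hd, w, hw, rfl⟩
    exact ⟨c + d, add_mem hc hd, v + w, add_mem hv hw, by ring⟩
  neg_mem' := by
    rintro _ ⟨c, hc, v, hv, rfl⟩
    exact ⟨-c, neg_mem hc, -v, neg_mem hv, by ring⟩

/-- `X'ₙ = (1 + Y Xₙ) / Y`. -/
def X' (n : ℕ) : L := (1 + Y * X n) / Y

/-- `D₀ = A₀` and `Dₙ₊₁ = Bₙ₊₁ ∩ Aₙ₊₁`, where `Bₙ₊₁ = Kr(Dₙ, b)` is the Kronecker function ring in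
the indeterminate `X'ₙ₊₁`. -/
def DRing : ℕ → Subring L
  | 0 => ARing k₀ X Z Y 0
  | n + 1 => kronecker (DRing n) (X' X Y (n + 1)) ⊓ ARing k₀ X Z Y (n + 1)

end Construction

section Concrete

variable (k₀ : Type*) [Field k₀] (r : ℕ)

/-- The indeterminates `X₀, X₁, …`, `Z₀, …, Z_{r-2}` and `Y`. -/
inductive Indet (r : ℕ) : Type
  | X (n : ℕ)
  | Z (i : Fin (r - 1))
  | Y

/-- The field of rational functions over `k₀` in all the indeterminates. -/
abbrev RatField : Type _ := FractionRing (MvPolynomial (Indet r) k₀)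

/-- An indeterminate as an element of the rational function field. -/
def indet (i : Indet r) : RatField k₀ r :=
  algebraMap (MvPolynomial (Indet r) k₀) (RatField k₀ r) (MvPolynomial.X i)

/-- The domains `D₀ ⊆ D₁ ⊆ …` for the given field `k₀` and the given `r`. -/
def essD (n : ℕ) : Subring (RatField k₀ r) :=
  DRing k₀ (fun i => indet k₀ r (.X i)) (fun i => indet k₀ r (.Z i)) (indet k₀ r .Y) n

end Concrete

end EssentialDomains

end

/-!
All rings live in one field `L`, generated over `k₀` by the algebraically independent elements `X₀,
X₁, …`, `Z₀, …, Z_{r-2}` and `Y`. Write `tₙ = Xₙ' = 1/Y + Xₙ`; then `1/tₙ ∈ Y Vₙ`, and `Kₙ₊₁` is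
the rational function field `Kₙ(tₙ₊₁)`. Let `Bₙ₊₁` be the Kronecker function ring of `Dₙ` in
`tₙ₊₁`.

**Valuation rings above `D`.** A valuation ring of `L` contains `Bₙ₊₁` if and only if it contains
`Dₙ` and is a Gauss extension with respect to `tₙ₊₁` (`isGauss_of_kronecker_le`,
`kronecker_le_of_isGauss`), and `Bₙ₊₁` is the intersection of these rings. If `a = f(t)/g(t)` with
`f, g ∈ Dₙ[T]`, `t = tₙ₊₁`, and `N > deg f`, then the content of `g T^N + f` contains those of `f`
and `g`, so `s = 1/(1 + a t^{-N})` and `s a` are in `Bₙ₊₁` (`exists_denominator`). It follows that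
`Bₙ₊₁` is `Dₙ₊₁[tₙ₊₁]`, that elements of `Aₙ₊₁` are fractions over `Dₙ₊₁` with denominators
congruent to `1` modulo `1/tₙ₊₁` (`exists_mul_mem_DAt`), and that a valuation ring `W ⊇ D` contains
`tₙ₊₁`, hence `Bₙ₊₁`, or contains `Aₙ₊₁` (`tAt_mem_or_AAt_le`). If `W` contains almost all `tₙ`, it
is a localization of `D` (`isFractional_of_tAt_mem`).

**`D` is essential.** `Dₙ` is an intersection of valuation rings of `Kₙ`, and each of them becomes
a valuation ring above `D` containing all later `tₘ` by taking Gauss extensions again and again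
(`exists_gauss_tower`).

**`D` is not locally essential.** The elements of `D` in `⋃ Y Vₙ` form a prime ideal, and the
localization there is `A = ⋃ Aₙ` (`isLocalization_AUnion`). This ring is local of dimension one,
and it is not a valuation ring since it contains neither `Z₀` nor `1/Z₀`; so it is not essential.

**Dimensions.** A prime of `D` which is not inside `⋃ Y Vₙ` contains only finitely many `1/tₙ`, so
that the localization there is a valuation ring (`exists_center_eq_of_mem`). Hence `dim D[T₁, …,
T_N]` is bounded by the dimensions of `A[T₁, …, T_N]` and of `W[T₁, …, T_N]`, for valuation rings
`W ⊇ D`. Both are estimated by an inequality for domains over a valuation ring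
(`ringKrullDim_le_of_algebraicIndependent`): the first by `N + r`, since `A` contains the field `k
= ⋃ kₙ`, over which `L` has transcendence degree at most `r`, and the second by `N + dim W`.
Moreover `dim W ≤ r`, because `W` contains a field `kₙ` such that, up to units, all elements of `L`
are in `Kₙ` (or `W` contains `k`). Conversely, the composite of the places of `Z₀, …, Z_{r-2}, Y`
gives a valuation ring of `K₀` of dimension at least `r`, and a tower of Gauss extensions above it
is a localization of `D` (`exists_isFractional_le_ringKrullDim`).
-/

noncomputable section

open Polynomial

namespace EssentialDomains

/-! ### Valuation rings dominating a prime -/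

section Domination

variable {L : Type*} [Field L]

/-- Every prime of a domain embedded in a field `L` is the center of a valuation ring of `L`. -/
theorem exists_valuationSubring_center {R : Type*} [CommRing R] (φ : R →+* L)
    (hφ : Function.Injective φ) (Q : Ideal R) [Q.IsPrime] :
    ∃ W : ValuationSubring L, ∀ a, φ a ∈ W ∧ (W.valuation (φ a) < 1 ↔ a ∈ Q) := by
  let e : R ≃+* φ.range := RingEquiv.ofBijective φ.rangeRestrict
    ⟨fun a b h => hφ (congrArg Subtype.val h), φ.rangeRestrict_surjective⟩
  let P : Ideal φ.range := Q.comap e.symm.toRingHom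
  have : P.IsPrime := Ideal.comap_isPrime _ _
  obtain ⟨W, hle, hloc⟩ := (LocalSubring.ofPrime φ.range P).exists_le_valuationSubring
  have hmem : ∀ x ∈ (LocalSubring.ofPrime φ.range P).toSubring, x ∈ W := hle
  refine ⟨W, fun a => ?_⟩
  let b : (LocalSubring.ofPrime φ.range P).toSubring := algebraMap φ.range _ (e a)
  have hb : (b : L) = φ a := rfl
  have haW : φ a ∈ W := hmem _ b.2
  refine ⟨haW, ?_⟩
  have h1 : (⟨φ a, haW⟩ : W) ∈ IsLocalRing.maximalIdeal W ↔
      b ∈ IsLocalRing.maximalIdeal (LocalSubring.ofPrime φ.range P).toSubring := by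
    rw [IsLocalRing.mem_maximalIdeal, IsLocalRing.mem_maximalIdeal, mem_nonunits_iff,
      mem_nonunits_iff, not_iff_not]
    exact isUnit_map_iff (Subring.inclusion hle) b
  rw [← ValuationSubring.valuation_lt_one_iff W ⟨φ a, haW⟩] at *
  rw [h1, IsLocalization.AtPrime.to_map_mem_maximal_iff _ P]
  change e.symm (e a) ∈ Q ↔ _
  rw [e.symm_apply_apply]

/-- The value of a polynomial in `t` over `R` is the maximum of the values of its coefficients: on
the field generated by `R` and `t`, the ring `W` is the Gauss extension of its restriction to the
quotient field of `R`. Only one inequality has to be required, since `t ∈ W`. -/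
def IsGauss (R : Type*) [CommRing R] [Algebra R L] (W : ValuationSubring L) (t : L) : Prop :=
  t ∈ W ∧ ∀ (f : R[X]) (i : ℕ), W.valuation (algebraMap R L (f.coeff i)) ≤ W.valuation (aeval t f)

theorem exists_coeff_max {R : Type*} [CommRing R] {Γ : Type*} [LinearOrderedCommGroupWithZero Γ]
    (v : Valuation R Γ) (f : R[X]) : ∃ i, ∀ j, v (f.coeff j) ≤ v (f.coeff i) := by
  by_cases h : f = 0
  · exact ⟨0, by simp [h]⟩
  · obtain ⟨i, -, hi⟩ := f.support.exists_max_image (fun i => v (f.coeff i))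
      (support_nonempty.2 h)
    refine ⟨i, fun j => ?_⟩
    by_cases hj : f.coeff j = 0
    · simp [hj]
    · exact hi j (mem_support_iff.2 hj)

theorem algebraMap_mem_iff_of_dominates {K : Type*} [Field K] [Algebra K L]
    {W₀ : ValuationSubring K} {W : ValuationSubring L} (h : ∀ a ∈ W₀, algebraMap K L a ∈ W)
    (h' : ∀ a ∈ W₀, W₀.valuation a < 1 → W.valuation (algebraMap K L a) < 1) (a : K) :
    algebraMap K L a ∈ W ↔ a ∈ W₀ := by
  refine ⟨fun ha => ?_, h a⟩
  by_contra ha₀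
  have h1 : W₀.valuation a⁻¹ < 1 := by
    rw [← ValuationSubring.mem_nonunits_iff, ValuationSubring.inv_mem_nonunits_iff]
    exact Or.inr ha₀
  have h2 := h' _ ((W₀.mem_or_inv_mem a).resolve_left ha₀) h1
  rw [map_inv₀, ← ValuationSubring.mem_nonunits_iff, ValuationSubring.inv_mem_nonunits_iff] at h2
  rcases h2 with h2 | h2
  · rw [map_eq_zero] at h2
    exact ha₀ (h2 ▸ W₀.zero_mem)
  · exact h2 ha

/-- The Gauss extension of a valuation ring of `K` to `K(t)`, extended further to `L`. -/
theorem exists_isGauss {K : Type*} [Field K] [Algebra K L] (W₀ : ValuationSubring K) {t : L}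
    (ht : Transcendental K t) :
    ∃ W : ValuationSubring L, (∀ a : K, algebraMap K L a ∈ W ↔ a ∈ W₀) ∧ IsGauss K W t := by
  let φ : W₀[X] →+* L := (aeval t : K[X] →ₐ[K] L).toRingHom.comp (mapRingHom W₀.subtype)
  have hφ : ∀ g, φ g = aeval t (g.map W₀.subtype) := fun _ => rfl
  have hinj : Function.Injective φ :=
    (transcendental_iff_injective.1 ht).comp (map_injective _ Subtype.val_injective)
  have := Ideal.isPrime_map_C_of_isPrime (P := IsLocalRing.maximalIdeal W₀)
  obtain ⟨W, hW⟩ := exists_valuationSubring_center φ hinj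
    ((IsLocalRing.maximalIdeal W₀).map Polynomial.C)
  have h1 : ∀ a ∈ W₀, algebraMap K L a ∈ W := fun a ha => by
    simpa [hφ] using (hW (C ⟨a, ha⟩)).1
  have h2 : ∀ a : K, algebraMap K L a ∈ W ↔ a ∈ W₀ := by
    refine algebraMap_mem_iff_of_dominates h1 fun a ha hlt => ?_
    have h4 := (hW (C ⟨a, ha⟩)).2.2 (Ideal.mem_map_of_mem _
      ((ValuationSubring.valuation_lt_one_iff W₀ ⟨a, ha⟩).2 hlt))
    simpa [hφ] using h4
  refine ⟨W, h2, by simpa [hφ] using (hW X).1, fun f i => ?_⟩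
  obtain ⟨j, hj⟩ := exists_coeff_max W₀.valuation f
  by_cases hc : f.coeff j = 0
  · have : f.coeff i = 0 := by simpa [hc] using hj i
    simp [this]
  have h3 : ∀ i, f.coeff i / f.coeff j ∈ W₀ := fun i => by
    rw [← W₀.valuation_le_one_iff, map_div₀]
    exact div_le_one_of_le₀ (hj i) zero_le
  -- divide `f` by a coefficient of largest value: the quotient has a coefficient `1`
  obtain ⟨g, hg⟩ : ∃ g : W₀[X], g.map W₀.subtype = C (f.coeff j)⁻¹ * f := by
    rw [← mem_lifts, lifts_iff_coeff_lifts]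
    intro n
    exact ⟨⟨_, h3 n⟩, by simp [div_eq_inv_mul]⟩
  have h4 : g ∉ (IsLocalRing.maximalIdeal W₀).map Polynomial.C := by
    rw [Ideal.mem_map_C_iff]
    intro h
    have h5 : g.coeff j = 1 := Subtype.ext <| by
      have := congrArg (coeff · j) hg
      simpa [hc] using this
    exact (Ideal.ne_top_iff_one _).1 (IsLocalRing.maximalIdeal.isMaximal W₀).ne_top (h5 ▸ h j)
  have h5 : W.valuation (φ g) = 1 := le_antisymm ((W.valuation_le_one_iff _).2 (hW g).1)
    (not_lt.1 fun h => h4 ((hW g).2.1 h))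
  have h6 : W.valuation (aeval t f) = W.valuation (algebraMap K L (f.coeff j)) := by
    rw [hφ, hg, map_mul, aeval_C, map_mul, map_inv₀, map_inv₀] at h5
    rw [inv_mul_eq_one₀ (by simpa using hc)] at h5
    exact h5.symm
  rw [h6]
  have h7 := h1 _ (h3 i)
  rw [← W.valuation_le_one_iff, map_div₀, map_div₀] at h7
  exact (div_le_one₀ (zero_lt_iff.2 (by simpa using hc))).1 h7

/-- The composite of the place `z = 0` of `F(z)` with a valuation ring of `F`, extended to `L`. -/
theorem exists_composite {F : Type*} [Field F] [Algebra F L] (W₀ : ValuationSubring F) {z : L}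
    (hz : Transcendental F z) :
    ∃ W : ValuationSubring L, (∀ a : F, algebraMap F L a ∈ W ↔ a ∈ W₀) ∧
      ∀ a : F, W.valuation (algebraMap F L a * z) < 1 := by
  let A : Subring F[X] := W₀.toSubring.comap constantCoeff
  let c : A →+* W₀ := constantCoeff.restrict A W₀.toSubring fun _ h => h
  have := Ideal.comap_isPrime c (IsLocalRing.maximalIdeal W₀)
  -- polynomials with constant term in `W₀`; the center is given by constant terms of value `< 1`
  obtain ⟨W, hW⟩ := exists_valuationSubring_center
    ((aeval z : F[X] →ₐ[F] L).toRingHom.comp A.subtype)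
    ((transcendental_iff_injective.1 hz).comp Subtype.val_injective)
    ((IsLocalRing.maximalIdeal W₀).comap c)
  have h1 : ∀ a ∈ W₀, algebraMap F L a ∈ W := fun a ha => by
    simpa using (hW ⟨C a, by simpa [A] using ha⟩).1
  refine ⟨W, algebraMap_mem_iff_of_dominates h1 fun a ha hlt => ?_, fun a => ?_⟩
  · have hA : C a ∈ A := by simpa [A] using ha
    have hc : c ⟨C a, hA⟩ = ⟨a, ha⟩ := Subtype.ext (coeff_C_zero (a := a))
    have h4 := (hW ⟨C a, hA⟩).2.2 (by
      rw [Ideal.mem_comap, hc]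
      exact (ValuationSubring.valuation_lt_one_iff W₀ ⟨a, ha⟩).2 hlt)
    simpa using h4
  · have h4 := (hW ⟨C a * X, by simp [A]⟩).2.2 (by
      rw [Ideal.mem_comap]
      convert Ideal.zero_mem _
      exact Subtype.ext (by change (C a * X).coeff 0 = 0; simp))
    simpa using h4

end Domination

/-! ### A dimension inequality over valuation rings -/

section Dimension

variable {W S : Type*} [CommRing W] [CommRing S] [Algebra W S]

/-- The residues of `y` modulo the prime `P` of the `W`-algebra `S` are algebraically independent
over `W / (P ∩ W)`. -/
def IndepMod (W : Type*) [CommRing W] [Algebra W S] (P : Ideal S) {m : ℕ} (y : Fin m → S) : Prop :=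
  ∀ f : MvPolynomial (Fin m) W, MvPolynomial.aeval y f ∈ P → ∀ d, algebraMap W S (f.coeff d) ∈ P

theorem exists_dvd_forall [IsDomain W] [ValuationRing W] {ι : Type*} (s : Finset ι)
    (hs : s.Nonempty) (g : ι → W) : ∃ i ∈ s, ∀ j ∈ s, g i ∣ g j := by
  induction hs using Finset.Nonempty.cons_induction with
  | singleton a => exact ⟨a, by simp⟩
  | cons a s h hs ih =>
    obtain ⟨i, hi, hij⟩ := ih
    rcases ValuationRing.dvd_total (g a) (g i) with h | h
    · refine ⟨a, by simp, fun j hj => ?_⟩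
      rcases Finset.mem_cons.1 hj with rfl | hj
      · rfl
      · exact h.trans (hij j hj)
    · refine ⟨i, by simp [hi], fun j hj => ?_⟩
      rcases Finset.mem_cons.1 hj with rfl | hj
      · exact h
      · exact hij j hj

/-- Relations can be divided by a coefficient of least value, so over a valuation ring independence
modulo a prime lifts to smaller primes. -/
theorem IndepMod.mono [IsDomain W] [ValuationRing W] {P P' : Ideal S} [P.IsPrime] [P'.IsPrime]
    (h : P' ≤ P) {m : ℕ} {y : Fin m → S} (hy : IndepMod W P y) : IndepMod W P' y := by
  intro f hf
  by_contra! hd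
  obtain ⟨d, hd⟩ := hd
  have hd0 : f.coeff d ≠ 0 := fun h0 => hd (by simp [h0])
  obtain ⟨i, -, hij⟩ := exists_dvd_forall f.support
    ⟨d, MvPolynomial.mem_support_iff.2 hd0⟩ f.coeff
  have hij' : ∀ j, f.coeff i ∣ f.coeff j := fun j => by
    by_cases hj : f.coeff j = 0
    · simp [hj]
    · exact hij j (MvPolynomial.mem_support_iff.2 hj)
  have hi : algebraMap W S (f.coeff i) ∉ P' := fun hi => hd (by
    obtain ⟨b, hb⟩ := hij' d
    rw [hb, map_mul]
    exact Ideal.mul_mem_right _ _ hi)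
  have hi0 : f.coeff i ≠ 0 := fun h0 => hi (by simp [h0])
  obtain ⟨g, hg⟩ := (MvPolynomial.C_dvd_iff_dvd_coeff (f.coeff i) f).2 hij'
  have hgi : g.coeff i = 1 := by
    have := congrArg (MvPolynomial.coeff i) hg
    rw [MvPolynomial.coeff_C_mul] at this
    exact (mul_eq_left₀ hi0).1 this.symm
  rw [hg, map_mul, MvPolynomial.aeval_C] at hf
  have h1 := hy g (h ((Ideal.IsPrime.mem_or_mem ‹_› hf).resolve_left hi)) i
  rw [hgi, map_one] at h1
  exact (Ideal.ne_top_iff_one P).1 Ideal.IsPrime.ne_top' h1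

/-- If two primes `P' ⊂ P` of `S` have the same trace on `W`, an element `z` of `P` outside of `P'`
increases the number of independent residues: in a relation for `z, y` modulo `P'`, the constant
term in `z` is a relation for `y` modulo `P`, and after removing it, the relation can be divided by
`z`. -/
theorem IndepMod.cons {P P' : Ideal S} [P.IsPrime] [P'.IsPrime] (h : P' ≤ P)
    (hPP' : P.comap (algebraMap W S) = P'.comap (algebraMap W S)) {m : ℕ} {y : Fin m → S}
    (hy : IndepMod W P y) {z : S} (hz : z ∈ P) (hz' : z ∉ P') :
    IndepMod W P' (Fin.cons z y : Fin (m + 1) → S) := by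
  have key : ∀ (n : ℕ) (p : (MvPolynomial (Fin m) W)[X]), p.natDegree ≤ n →
      p.eval₂ (MvPolynomial.aeval y : MvPolynomial (Fin m) W →ₐ[W] S).toRingHom z ∈ P' →
      ∀ i d, algebraMap W S ((p.coeff i).coeff d) ∈ P' := by
    intro n
    induction n with
    | zero =>
      intro p hp hpP i d
      rw [Polynomial.eq_C_of_natDegree_le_zero hp, eval₂_C] at hpP
      have h1 := hy _ (h hpP) d
      rcases i with _ | i
      · change _ ∈ P'.comap _
        rw [← hPP']
        exact h1
      · rw [coeff_eq_zero_of_natDegree_lt (by lia)]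
        simp
    | succ n ih =>
      intro p hp hpP
      rw [← divX_mul_X_add p, eval₂_add, eval₂_mul, eval₂_X, eval₂_C] at hpP
      have h1 : MvPolynomial.aeval y (p.coeff 0) ∈ P := by
        have := h hpP
        exact (Ideal.add_mem_iff_right _ (Ideal.mul_mem_left _ _ hz)).1 this
      have h2 : ∀ d, algebraMap W S ((p.coeff 0).coeff d) ∈ P' := fun d => by
        change _ ∈ P'.comap _
        rw [← hPP']
        exact hy _ h1 d
      have h3 : MvPolynomial.aeval y (p.coeff 0) ∈ P' := by
        rw [MvPolynomial.aeval_def, MvPolynomial.eval₂_eq]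
        exact Ideal.sum_mem _ fun d _ => Ideal.mul_mem_right _ _ (h2 d)
      have h4 := (Ideal.IsPrime.mem_or_mem ‹_›
        ((Ideal.add_mem_iff_left _ h3).1 hpP)).resolve_right hz'
      intro i d
      rcases i with _ | i
      · exact h2 d
      · rw [← coeff_divX]
        exact ih _ (by rw [natDegree_divX_eq_natDegree_tsub_one]; lia) h4 i d
  intro f hf d
  have h1 : (MvPolynomial.finSuccEquiv W m f).eval₂
      (MvPolynomial.aeval y : MvPolynomial (Fin m) W →ₐ[W] S).toRingHom z =
      MvPolynomial.aeval (Fin.cons z y : Fin (m + 1) → S) f := by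
    let φ : MvPolynomial (Fin (m + 1)) W →ₐ[W] S :=
      { toRingHom := (eval₂RingHom
          (MvPolynomial.aeval y : MvPolynomial (Fin m) W →ₐ[W] S).toRingHom z).comp
          (MvPolynomial.finSuccEquiv W m).toRingEquiv.toRingHom
        commutes' := fun a => by
          have : MvPolynomial.finSuccEquiv W m (algebraMap W _ a) = C (MvPolynomial.C a) := by
            rw [AlgEquiv.commutes]
            rfl
          change eval₂ _ z (MvPolynomial.finSuccEquiv W m (algebraMap W _ a)) = _
          simp only [this, eval₂_C]
          exact (MvPolynomial.aeval y).commutes a }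
    have h2 : φ = MvPolynomial.aeval (Fin.cons z y : Fin (m + 1) → S) := by
      apply MvPolynomial.algHom_ext
      intro i
      refine Fin.cases ?_ (fun i => ?_) i
      · simp [φ, MvPolynomial.finSuccEquiv_X_zero]
      · simp [φ, MvPolynomial.finSuccEquiv_X_succ]
    exact DFunLike.congr_fun h2 f
  have := key _ (MvPolynomial.finSuccEquiv W m f) le_rfl (h1 ▸ hf) (d 0) d.tail
  rwa [MvPolynomial.finSuccEquiv_coeff_coeff, Finsupp.cons_tail] at this

/-- Each step of a chain of primes of `S` lengthens the chain of traces on `W` or increases the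
number of independent residues. -/
theorem exists_indepMod [IsDomain W] [ValuationRing W] (n : ℕ) :
    ∀ p : Fin (n + 1) → PrimeSpectrum S, StrictMono p → ∃ (m : ℕ) (y : Fin m → S),
      IndepMod W (p 0).asIdeal y ∧ ∃ q : LTSeries (PrimeSpectrum W),
        q.head = (p 0).comap (algebraMap W S) ∧ n ≤ m + q.length := by
  induction n with
  | zero =>
    refine fun p _ => ⟨0, Fin.elim0, fun f hf d => ?_, RelSeries.singleton _ _, rfl, by simp⟩
    rw [MvPolynomial.eq_C_of_isEmpty f, MvPolynomial.aeval_C] at hf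
    rwa [Subsingleton.elim d 0]
  | succ n ih =>
    intro p hp
    obtain ⟨m, y, hy, q, hq, hn⟩ := ih (fun i => p i.succ) (hp.comp (Fin.strictMono_succ))
    have hlt : p 0 < p (Fin.succ 0) := hp (Fin.succ_pos 0)
    have hle : (p 0).asIdeal ≤ (p (Fin.succ 0)).asIdeal := hlt.le
    by_cases h : (p 0).comap (algebraMap W S) = (p (Fin.succ 0)).comap (algebraMap W S)
    · obtain ⟨z, hz, hz'⟩ := SetLike.exists_of_lt (show (p 0).asIdeal < _ from hlt)
      refine ⟨m + 1, Fin.cons z y, hy.cons hle ?_ hz hz', q, by rw [hq, h], by lia⟩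
      exact (congrArg PrimeSpectrum.asIdeal h).symm
    · have hlt' : (p 0).comap (algebraMap W S) < q.head := by
        rw [hq]
        exact lt_of_le_of_ne (Ideal.comap_mono hle) h
      exact ⟨m, y, hy.mono hle, q.cons _ hlt', by simp, by simp; lia⟩

/-- A domain `S` containing a valuation ring `W` such that families algebraically independent over
`W` have at most `N` elements has dimension at most `N + dim W`. -/
theorem ringKrullDim_le_of_algebraicIndependent [IsDomain W] [ValuationRing W] [IsDomain S]
    [FaithfulSMul W S] (N : ℕ)
    (h : ∀ (m : ℕ) (y : Fin m → S), AlgebraicIndependent W y → m ≤ N) :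
    ringKrullDim S ≤ N + ringKrullDim W := by
  refine iSup_le fun p => ?_
  obtain ⟨m, y, hy, q, -, hn⟩ := exists_indepMod (W := W) p.length p.toFun p.strictMono
  have h1 : m ≤ N := by
    refine h m y ((injective_iff_map_eq_zero _).2 fun f hf => ?_)
    have h2 : IndepMod W (⊥ : Ideal S) y := hy.mono bot_le
    ext d
    simpa using h2 f (by simpa using hf) d
  calc ((p.length : ℕ∞) : WithBot ℕ∞) ≤ ((N + q.length : ℕ) : WithBot ℕ∞) := by
        exact_mod_cast hn.trans (Nat.add_le_add_right h1 _)
    _ = N + (q.length : WithBot ℕ∞) := by push_cast; rfl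
    _ ≤ _ := by
        gcongr
        exact le_iSup (fun q : LTSeries (PrimeSpectrum W) => ((q.length : ℕ∞) : WithBot ℕ∞)) q

end Dimension

/-! ### Chains of primes in a valuation ring -/

section Rank

variable {L : Type*} [Field L]

/-- The radical of the ideal of elements of value at most `c < 1` is a prime. -/
def radicalPrime (W : ValuationSubring L) (c : W.ValueGroup) (hc : c < 1) : PrimeSpectrum W where
  asIdeal :=
    { carrier := {w | ∃ n : ℕ, W.valuation w ^ n ≤ c}
      zero_mem' := ⟨1, by simp⟩
      add_mem' := by
        rintro a b ⟨n, hn⟩ ⟨k, hk⟩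
        rcases le_total (W.valuation a) (W.valuation b) with h | h
        · refine ⟨k, le_trans (pow_le_pow_left' ?_ k) hk⟩
          exact (W.valuation.map_add a b).trans (max_le h le_rfl)
        · refine ⟨n, le_trans (pow_le_pow_left' ?_ n) hn⟩
          exact (W.valuation.map_add a b).trans (max_le le_rfl h)
      smul_mem' := by
        rintro a b ⟨n, hn⟩
        refine ⟨n, (pow_le_pow_left' ?_ n).trans hn⟩
        rw [smul_eq_mul, MulMemClass.coe_mul, map_mul]
        exact mul_le_of_le_one_left' (W.valuation_le_one a) }
  isPrime := by
    refine (Ideal.isPrime_iff).2 ⟨fun h => ?_, ?_⟩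
    · obtain ⟨n, hn⟩ := (Ideal.eq_top_iff_one _).1 h
      simp only [OneMemClass.coe_one, map_one, one_pow] at hn
      exact not_le.2 hc hn
    · rintro a b ⟨n, hn⟩
      rw [MulMemClass.coe_mul, map_mul] at hn
      rcases le_total (W.valuation a) (W.valuation b) with h | h
      · refine Or.inl ⟨2 * n, le_trans ?_ hn⟩
        rw [pow_mul, pow_two]
        exact pow_le_pow_left' (mul_le_mul_right h _) n
      · refine Or.inr ⟨2 * n, le_trans ?_ hn⟩
        rw [pow_mul, pow_two]
        exact pow_le_pow_left' (mul_le_mul_left h _) n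

/-- Elements `z₀, …, z_r` of the maximal ideal, each infinitely small compared to the next ones,
give a chain of `r + 1` primes. -/
theorem natCast_le_ringKrullDim {W : ValuationSubring L} {r : ℕ} (z : Fin (r + 1) → L)
    (hz : ∀ i, W.valuation (z i) < 1)
    (h : ∀ i j, i < j → z j ≠ 0 ∧ ∀ n : ℕ, W.valuation (z i) ≤ W.valuation (z j) ^ n) :
    (r : WithBot ℕ∞) ≤ ringKrullDim W := by
  let p : Fin (r + 1) → PrimeSpectrum W := fun i => radicalPrime W _ (hz i)
  have hp : StrictMono p := by
    intro i j hij
    obtain ⟨hj, hn⟩ := h i j hij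
    refine lt_of_le_not_ge ?_ ?_
    · rintro w ⟨n, hw⟩
      exact ⟨n, hw.trans (by simpa using hn 1)⟩
    · intro hle
      have hzW : z j ∈ W := (W.valuation_le_one_iff _).1 (hz j).le
      obtain ⟨n, hn'⟩ := hle (show (⟨z j, hzW⟩ : W) ∈ (p j).asIdeal from ⟨1, by simp⟩)
      have h1 := hn'.trans (hn (n + 1))
      rw [pow_succ] at h1
      have h2 : 0 < W.valuation (z j) ^ n := pow_pos (zero_lt_iff.2 (by simpa using hj)) n
      have h3 := mul_lt_mul_of_pos_left (hz j) h2
      rw [mul_one] at h3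
      exact absurd h1 (not_le.2 h3)
  exact le_iSup (fun q : LTSeries (PrimeSpectrum W) => ((q.length : ℕ∞) : WithBot ℕ∞))
    (LTSeries.mk r p hp)

end Rank

/-! ### Kronecker function rings and Gauss extensions -/

section KroneckerRing

variable {L : Type*} [Field L]

theorem valuation_aeval_le {R : Type*} [CommRing R] [Algebra R L] {W : ValuationSubring L} {t : L}
    (ht : t ∈ W) (f : R[X]) {c : W.ValueGroup}
    (h : ∀ i, W.valuation (algebraMap R L (f.coeff i)) ≤ c) : W.valuation (aeval t f) ≤ c := by
  rw [aeval_eq_sum_range]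
  refine W.valuation.map_sum_le fun i _ => ?_
  rw [Algebra.smul_def, map_mul, map_pow]
  exact (mul_le_of_le_one_right' (pow_le_one' ((W.valuation_le_one_iff t).2 ht) i)).trans (h i)

theorem IsGauss.exists_eq {R : Type*} [CommRing R] [Algebra R L] {W : ValuationSubring L} {t : L}
    (h : IsGauss R W t) (f : R[X]) :
    ∃ i, W.valuation (aeval t f) = W.valuation (algebraMap R L (f.coeff i)) := by
  obtain ⟨i, hi⟩ := exists_coeff_max (W.valuation.comap (algebraMap R L)) f
  exact ⟨i, le_antisymm (valuation_aeval_le h.1 f hi) (h.2 f i)⟩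

section Content

variable {E : Type*} [Field E] {W : ValuationSubring E} {f g : W[X]}

theorem valuation_coeff_le (h : f.contentIdeal ≤ g.contentIdeal) {c : W.ValueGroup}
    (hg : ∀ j, W.valuation (g.coeff j) ≤ c) (i : ℕ) : W.valuation (f.coeff i) ≤ c := by
  let I : Ideal W :=
    { carrier := {a | W.valuation a ≤ c}
      zero_mem' := by simp
      add_mem' := fun {a b} ha hb => (W.valuation.map_add a b).trans (max_le ha hb)
      smul_mem' := fun a b hb => by
        change W.valuation ((a * b : W) : E) ≤ c
        rw [MulMemClass.coe_mul, map_mul]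
        exact (mul_le_of_le_one_left' (W.valuation_le_one a)).trans hb }
  have h1 : g.contentIdeal ≤ I := by
    rw [contentIdeal_def, Ideal.span_le]
    intro x hx
    obtain ⟨n, -, rfl⟩ := mem_coeffs_iff.1 hx
    exact hg n
  exact (h.trans h1) (coeff_mem_contentIdeal f i)

theorem contentIdeal_le_of_valuation_le {j : ℕ}
    (h : ∀ i, W.valuation (f.coeff i) ≤ W.valuation (g.coeff j)) :
    f.contentIdeal ≤ g.contentIdeal := by
  rw [contentIdeal_def, Ideal.span_le]
  intro x hx
  obtain ⟨n, -, rfl⟩ := mem_coeffs_iff.1 hx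
  obtain ⟨a, ha⟩ := (W.valuation_le_iff _ _).1 (h n)
  have : a * g.coeff j = f.coeff n := Subtype.ext ha
  rw [← this]
  exact Ideal.mul_mem_left _ _ (coeff_mem_contentIdeal g j)

end Content

theorem coe_toOverring {R E : Type*} [CommRing R] [Field E] [Algebra R E] {W : ValuationSubring E}
    (hW : W ∈ valuationOverrings R E) (a : R) : (toOverring hW a : E) = algebraMap R E a := rfl

theorem ContentLE.of_contentIdeal_le {R E : Type*} [CommRing R] [Field E] [Algebra R E]
    {f g : R[X]} (h : f.contentIdeal ≤ g.contentIdeal) : ContentLE R E f g := by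
  rw [contentLE_iff]
  intro W hW
  rw [contentIdeal_map_eq_map_contentIdeal, contentIdeal_map_eq_map_contentIdeal]
  exact Ideal.map_mono h

theorem contentIdeal_one_le_X_pow {R : Type*} [CommRing R] (n : ℕ) :
    (1 : R[X]).contentIdeal ≤ (X ^ n : R[X]).contentIdeal := by
  have := coeff_mem_contentIdeal (X ^ n : R[X]) n
  rw [coeff_X_pow_self] at this
  rw [(Ideal.eq_top_iff_one _).2 this]
  exact le_top

variable {R : Type*} [CommRing R] [IsDomain R] [Algebra R L]

theorem div_mem_kronecker {t : L} {f g : R[X]} (hg : aeval t g ≠ 0)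
    (h : f.contentIdeal ≤ g.contentIdeal) : aeval t f / aeval t g ∈ kronecker R t :=
  ⟨f, g, hg, .of_contentIdeal_le h, rfl⟩

theorem algebraMap_mem_kronecker (t : L) (a : R) : algebraMap R L a ∈ kronecker R t := by
  simpa using div_mem_kronecker (t := t) (f := C a) (g := 1) (by simp) (by simp)

theorem mem_kronecker_self (t : L) : t ∈ kronecker R t := by
  simpa using div_mem_kronecker (R := R) (t := t) (f := X) (g := 1) (by simp) (by simp)

theorem inv_pow_mem_kronecker {t : L} (ht : t ≠ 0) (n : ℕ) : (t⁻¹) ^ n ∈ kronecker R t := by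
  simpa using div_mem_kronecker (R := R) (t := t) (f := 1) (g := X ^ n) (by simp [ht])
    (contentIdeal_one_le_X_pow n)

/-- The coefficients of `f`, divided by `f(t)`, are in the Kronecker function ring. -/
theorem isGauss_of_kronecker_le {W : ValuationSubring L} {t : L}
    (h : kronecker R t ≤ W.toSubring) (ht : Transcendental R t) : IsGauss R W t := by
  refine ⟨h (mem_kronecker_self t), fun f i => ?_⟩
  by_cases hf : aeval t f = 0
  · simp [(transcendental_iff.1 ht) f hf]
  have h1 := h (div_mem_kronecker (f := C (f.coeff i)) hf (by
    rw [contentIdeal_C, Ideal.span_singleton_le_iff_mem]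
    exact coeff_mem_contentIdeal f i))
  rw [ValuationSubring.mem_toSubring, ← W.valuation_le_one_iff, map_div₀, aeval_C] at h1
  exact (div_le_one₀ (zero_lt_iff.2 (by simpa using hf))).1 h1

/-- For `N > deg f`, the polynomials `g T^N` and `f` have no monomial in common, so that the content
of `g T^N + f` contains those of both. Hence `g T^N` and `f T^N`, divided by `g T^N + f`, are in the
Kronecker function ring. -/
theorem exists_denominator {t : L} (ht : Transcendental R t) {a : L} {f g : R[X]}
    (hg : aeval t g ≠ 0) (ha : a = aeval t f / aeval t g) {N : ℕ} (hN : f.natDegree < N) :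
    1 + a * (t⁻¹) ^ N ≠ 0 ∧ (1 + a * (t⁻¹) ^ N)⁻¹ ∈ kronecker R t ∧
      (1 + a * (t⁻¹) ^ N)⁻¹ * a ∈ kronecker R t := by
  have ht0 : t ≠ 0 := fun h => ht (h ▸ isAlgebraic_zero)
  have hg0 : g ≠ 0 := fun h => hg (by simp [h])
  have hcg : ∀ i, (g * X ^ N + f).coeff (i + N) = g.coeff i := fun i => by
    rw [coeff_add, coeff_mul_X_pow, coeff_eq_zero_of_natDegree_lt (p := f) (by lia), add_zero]
  have hcf : ∀ i < N, (g * X ^ N + f).coeff i = f.coeff i := fun i hi => by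
    rw [coeff_add, coeff_mul_X_pow', if_neg (by lia), zero_add]
  have h0 : g * X ^ N + f ≠ 0 := fun h => hg0 (by
    ext i
    rw [← hcg i, h, coeff_zero, coeff_zero])
  have h1 : aeval t (g * X ^ N + f) ≠ 0 := fun h => h0 (transcendental_iff.1 ht _ h)
  have hle : ∀ {p : R[X]}, (∀ i, p.coeff i ∈ (g * X ^ N + f).contentIdeal) →
      p.contentIdeal ≤ (g * X ^ N + f).contentIdeal := fun {p} hp => by
    rw [contentIdeal_def, Ideal.span_le]
    intro x hx
    obtain ⟨n, -, rfl⟩ := mem_coeffs_iff.1 hx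
    exact hp n
  have hgi : ∀ i, g.coeff i ∈ (g * X ^ N + f).contentIdeal := fun i =>
    hcg i ▸ coeff_mem_contentIdeal _ _
  have hfi : ∀ i, f.coeff i ∈ (g * X ^ N + f).contentIdeal := fun i => by
    rcases lt_or_ge i N with hi | hi
    · exact hcf i hi ▸ coeff_mem_contentIdeal _ _
    · rw [coeff_eq_zero_of_natDegree_lt (by lia)]
      exact Ideal.zero_mem _
  have hmul : ∀ {p : R[X]}, (∀ i, p.coeff i ∈ (g * X ^ N + f).contentIdeal) →
      ∀ i, (p * X ^ N).coeff i ∈ (g * X ^ N + f).contentIdeal := fun {p} hp i => by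
    rw [coeff_mul_X_pow']
    split_ifs
    · exact hp _
    · exact Ideal.zero_mem _
  have h2 : aeval t (g * X ^ N + f) = (1 + a * (t⁻¹) ^ N) * (aeval t g * t ^ N) := by
    rw [ha, map_add, map_mul, map_pow, aeval_X, inv_pow]
    field_simp
  have h3 : 1 + a * (t⁻¹) ^ N ≠ 0 := fun h => h1 (by rw [h2, h, zero_mul])
  refine ⟨h3, ?_, ?_⟩
  · convert div_mem_kronecker h1 (hle (hmul hgi)) using 1
    rw [h2, map_mul, map_pow, aeval_X]
    field_simp
  · convert div_mem_kronecker h1 (hle (hmul hfi)) using 1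
    rw [h2, map_mul, map_pow, aeval_X, ha]
    field_simp

variable [FaithfulSMul R L]

attribute [local instance] FractionRing.liftAlgebra

/-- Membership in `Kr(R, b)` is tested on the restriction of `W` to the quotient field of `R`,
which is a valuation overring of `R`. -/
theorem kronecker_le_of_isGauss {W : ValuationSubring L} (hR : ∀ a : R, algebraMap R L a ∈ W)
    {t : L} (h : IsGauss R W t) : kronecker R t ≤ W.toSubring := by
  rintro _ ⟨f, g, hg, hfg, rfl⟩
  rw [ValuationSubring.mem_toSubring, ← W.valuation_le_one_iff, map_div₀]
  refine div_le_one_of_le₀ (valuation_aeval_le h.1 f fun i => ?_) zero_le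
  rw [contentLE_iff] at hfg
  let W' := W.comap (algebraMap (FractionRing R) L)
  have hW' : W' ∈ valuationOverrings R (FractionRing R) := fun a => by
    rw [ValuationSubring.mem_comap, ← IsScalarTower.algebraMap_apply]
    exact hR a
  obtain ⟨j, hj⟩ := exists_coeff_max W'.valuation (g.map (algebraMap R (FractionRing R)))
  have h1 := valuation_coeff_le (hfg W' hW') (c := W'.valuation (algebraMap R _ (g.coeff j)))
    (fun i => by simpa [coe_toOverring] using hj i) i
  rw [W'.valuation_le_iff] at h1
  obtain ⟨⟨a, ha⟩, hag⟩ := h1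
  have h2 : algebraMap (FractionRing R) L a * algebraMap R L (g.coeff j) =
      algebraMap R L (f.coeff i) := by
    rw [IsScalarTower.algebraMap_apply R (FractionRing R) L, ← map_mul, hag, coeff_map,
      IsScalarTower.algebraMap_apply R (FractionRing R) L]
    rfl
  rw [← h2, map_mul]
  exact (mul_le_of_le_one_left' ((W.valuation_le_one_iff _).2 ha)).trans (h.2 g j)

/-- `Kr(R, b)` is the intersection of the Gauss extensions of the valuation overrings of `R`. -/
theorem exists_isGauss_notMem_of_notMem_kronecker {t : L} (ht : Transcendental R t) {f g : R[X]}
    (hg : aeval t g ≠ 0) (h : aeval t f / aeval t g ∉ kronecker R t) :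
    ∃ W : ValuationSubring L, (∀ a : R, algebraMap R L a ∈ W) ∧ IsGauss R W t ∧
      aeval t f / aeval t g ∉ W := by
  have hfg : ¬ ContentLE R (FractionRing R) f g := fun hfg => h ⟨f, g, hg, hfg, rfl⟩
  rw [contentLE_iff] at hfg
  push Not at hfg
  obtain ⟨W₀, hW₀, hfg⟩ := hfg
  have ht' : Transcendental (FractionRing R) t := fun h =>
    ht ((IsFractionRing.isAlgebraic_iff R (FractionRing R) L).2 h)
  obtain ⟨W, hW, hG⟩ := exists_isGauss W₀ ht'
  have hG' : IsGauss R W t := ⟨hG.1, fun f i => by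
    have := hG.2 (f.map (algebraMap R (FractionRing R))) i
    rwa [aeval_map_algebraMap, coeff_map, ← IsScalarTower.algebraMap_apply] at this⟩
  have hR : ∀ a : R, algebraMap R L a ∈ W := fun a => by
    rw [IsScalarTower.algebraMap_apply R (FractionRing R) L, hW]
    exact hW₀ a
  refine ⟨W, hR, hG', fun hmem => hfg ?_⟩
  obtain ⟨j, hj⟩ := hG'.exists_eq g
  have hj0 : algebraMap R L (g.coeff j) ≠ 0 := fun h0 => hg (by simpa [h0] using hj)
  refine contentIdeal_le_of_valuation_le (j := j) fun i => ?_
  rw [← W.valuation_le_one_iff, map_div₀,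
    div_le_one₀ (zero_lt_iff.2 (by simpa using hg)), hj] at hmem
  have h1 := (hG'.2 f i).trans hmem
  rw [W₀.valuation_le_iff]
  refine ⟨⟨algebraMap R (FractionRing R) (f.coeff i) / algebraMap R (FractionRing R) (g.coeff j),
    (hW _).1 ?_⟩, ?_⟩
  · rw [map_div₀, ← IsScalarTower.algebraMap_apply, ← IsScalarTower.algebraMap_apply,
      ← W.valuation_le_one_iff, map_div₀]
    exact div_le_one_of_le₀ h1 zero_le
  · have : algebraMap R (FractionRing R) (g.coeff j) ≠ 0 := fun h0 => hj0 (by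
      rw [IsScalarTower.algebraMap_apply R (FractionRing R) L, h0, map_zero])
    simp [coe_toOverring, this]

end KroneckerRing

/-! ### Fields generated by sets of indeterminates -/

section Generators

variable {k₀ L ι : Type*} [Field k₀] [Field L] [Algebra k₀ L]

/-- The field generated over `k₀` by the elements `x i` with `i ∈ S`. -/
abbrev gen (k₀ : Type*) {L ι : Type*} [Field k₀] [Field L] [Algebra k₀ L] (x : ι → L) (S : Set ι) :
    IntermediateField k₀ L :=
  IntermediateField.adjoin k₀ (x '' S)

variable {x : ι → L}

theorem mem_gen {S : Set ι} {i : ι} (hi : i ∈ S) : x i ∈ gen k₀ x S :=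
  IntermediateField.subset_adjoin _ _ ⟨i, hi, rfl⟩

theorem gen_mono {S T : Set ι} (h : S ⊆ T) : gen k₀ x S ≤ gen k₀ x T :=
  IntermediateField.adjoin.mono _ _ _ (Set.image_mono h)

theorem mem_adjoin_simple_iff' {K : Type*} [Field K] [Algebra K L] {t a : L} :
    a ∈ IntermediateField.adjoin K {t} ↔
      ∃ f g : K[X], aeval t g ≠ 0 ∧ a = aeval t f / aeval t g := by
  rw [IntermediateField.mem_adjoin_simple_iff]
  constructor
  · rintro ⟨f, g, rfl⟩
    by_cases hg : aeval t g = 0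
    · exact ⟨0, 1, by simp, by simp [hg]⟩
    · exact ⟨f, g, hg, rfl⟩
  · rintro ⟨f, g, -, h⟩
    exact ⟨f, g, h⟩

theorem mem_gen_union {S : Set ι} {T : Set ι} {a : L} :
    a ∈ gen k₀ x (S ∪ T) ↔ a ∈ IntermediateField.adjoin (gen k₀ x S) (x '' T) := by
  rw [gen, Set.image_union, ← IntermediateField.adjoin_adjoin_left,
    IntermediateField.mem_restrictScalars]

theorem mem_gen_insert {S : Set ι} {i : ι} {a : L} :
    a ∈ gen k₀ x (insert i S) ↔
      ∃ f g : (gen k₀ x S)[X], aeval (x i) g ≠ 0 ∧ a = aeval (x i) f / aeval (x i) g := by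
  rw [← Set.union_singleton, mem_gen_union, Set.image_singleton, mem_adjoin_simple_iff']

variable (hx : AlgebraicIndependent k₀ x)

include hx

theorem transcendental_gen {S : Set ι} {i : ι} (hi : i ∉ S) :
    Transcendental (gen k₀ x S) (x i) := by
  open IntermediateField.algebraAdjoinAdjoin in
  intro h
  exact hx.transcendental_adjoin hi ((IsFractionRing.isAlgebraic_iff (Algebra.adjoin k₀ (x '' S))
    (gen k₀ x S) L).2 h)

theorem notMem_gen {S : Set ι} {i : ι} (hi : i ∉ S) : x i ∉ gen k₀ x S := fun h =>
  transcendental_gen hx hi (isAlgebraic_algebraMap (⟨x i, h⟩ : gen k₀ x S))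

omit hx in
/-- A field is algebraically closed in a simple transcendental extension. -/
theorem mem_range_of_isAlgebraic {K : Type*} [Field K] [Algebra K L] {t : L}
    (ht : Transcendental K t) {a : L} (ha : a ∈ IntermediateField.adjoin K {t})
    (h : IsAlgebraic K a) : a ∈ (algebraMap K L).range := by
  let e := RatFunc.algEquivOfTranscendental t ht
  have h1 : IsAlgebraic K (e.symm ⟨a, ha⟩) := by
    have h2 : IsAlgebraic K (⟨a, ha⟩ : IntermediateField.adjoin K {t}) :=
      (isAlgebraic_algHom_iff (IntermediateField.val _) Subtype.val_injective).1 h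
    exact h2.algHom e.symm.toAlgHom
  have h2 : ∃ c, e.symm ⟨a, ha⟩ = RatFunc.C c := by
    by_contra hc
    exact RatFunc.transcendental_of_ne_C _ hc h1
  obtain ⟨c, hc⟩ := h2
  refine ⟨c, ?_⟩
  have h3 : (⟨a, ha⟩ : IntermediateField.adjoin K {t}) = e (algebraMap K (RatFunc K) c) := by
    rw [RatFunc.algebraMap_eq_C, ← hc, e.apply_symm_apply]
  rw [e.commutes] at h3
  exact (congrArg Subtype.val h3).symm

/-- A field generated by some of the indeterminates is algebraically closed in the field generated
by finitely many more. -/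
theorem mem_gen_of_isAlgebraic {S : Set ι} (T : Finset ι) {a : L} (ha : a ∈ gen k₀ x (S ∪ T))
    (h : IsAlgebraic (gen k₀ x S) a) : a ∈ gen k₀ x S := by
  classical
  induction T using Finset.induction_on with
  | empty => simpa using ha
  | insert i T hi ih =>
    refine ih ?_
    by_cases hiS : i ∈ S ∪ T
    · rwa [Finset.coe_insert, Set.union_insert, Set.insert_eq_of_mem hiS] at ha
    rw [Finset.coe_insert, Set.union_insert, ← Set.union_singleton, mem_gen_union,
      Set.image_singleton] at ha
    have hle : gen k₀ x S ≤ gen k₀ x (S ∪ T) := gen_mono Set.subset_union_left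
    have h1 : IsAlgebraic (gen k₀ x (S ∪ T)) a := by
      algebraize [(IntermediateField.inclusion hle).toRingHom]
      have : IsScalarTower (gen k₀ x S) (gen k₀ x (S ∪ T)) L := .of_algebraMap_eq fun _ => rfl
      exact h.tower_top _
    obtain ⟨b, rfl⟩ := mem_range_of_isAlgebraic (transcendental_gen hx hiS) ha h1
    exact b.2

omit hx in
/-- Algebraically independent families in a field generated by a finite set `T` have at most `#T`
elements. -/
theorem le_card_of_algebraicIndependent {K : Type*} [Field K] [Algebra K L] (T : Finset ι) {m : ℕ}
    (y : Fin m → L) (hy : AlgebraicIndependent K y)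
    (hyT : ∀ i, y i ∈ IntermediateField.adjoin K (x '' T)) : m ≤ T.card := by
  classical
  let M := AlgebraicIndependent.matroid K L
  have h1 : M.Indep (Set.range y) := by
    rw [AlgebraicIndependent.matroid_indep_iff]
    exact hy.coe_range
  have h2 : Set.range y ⊆ M.closure (x '' T) := by
    rintro _ ⟨i, rfl⟩
    rw [AlgebraicIndependent.matroid_closure_eq]
    change IsAlgebraic (Algebra.adjoin K (x '' T)) (y i)
    obtain ⟨a, ha, b, hb, hab⟩ := IntermediateField.mem_adjoin_iff_div.1 (hyT i)
    rw [hab]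
    have ha' := isAlgebraic_algebraMap (A := L) (⟨a, ha⟩ : Algebra.adjoin K (x '' T))
    have hb' := isAlgebraic_algebraMap (A := L) (⟨b, hb⟩ : Algebra.adjoin K (x '' T))
    rw [div_eq_mul_inv]
    exact ha'.mul hb'.inv
  have h3 : (Set.range y).encard ≤ (x '' T).encard := calc
    _ ≤ M.eRk (M.closure (x '' T)) := h1.encard_le_eRk_of_subset h2
    _ = M.eRk (x '' T) := M.eRk_closure_eq _
    _ ≤ _ := M.eRk_le_encard _
  have h4 : (m : ℕ∞) ≤ T.card := calc
    (m : ℕ∞) = (Set.range y).encard := by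
      rw [← Set.image_univ, hy.injective.encard_image, Set.encard_univ]
      simp
    _ ≤ (x '' T).encard := h3
    _ ≤ (T : Set ι).encard := Set.encard_image_le _ _
    _ = T.card := Set.encard_coe_eq_coe_finsetCard T
  exact_mod_cast h4

omit hx in
theorem trdeg_le_card {K : Type*} [Field K] [Algebra K L] (T : Finset ι)
    (h : ∀ a : L, a ∈ IntermediateField.adjoin K (x '' T)) : Algebra.trdeg K L ≤ T.card := by
  obtain ⟨s, hs⟩ := exists_isTranscendenceBasis K L
  rw [← hs.cardinalMk_eq_trdeg]
  by_contra! hlt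
  obtain ⟨u, hu⟩ := Cardinal.exists_finset_le_card s (T.card + 1)
    (by rw [Nat.cast_add_one, Cardinal.natCast_add_one_le_iff]; exact hlt)
  have := le_card_of_algebraicIndependent T (fun i => ((u.equivFin.symm i : s) : L))
    (hs.1.comp _ (Subtype.val_injective.comp u.equivFin.symm.injective)) fun i => h _
  lia

end Generators

/-! ### The rings `Vₙ` and `Aₙ` -/

section Local

variable {k₀ L : Type*} [Field k₀] [Field L] [Algebra k₀ L] {r : ℕ} {x : Indet r → L}

/-- The set of the indeterminates of `kₙ`. -/
def kSet (r n : ℕ) : Set (Indet r) := Indet.X '' Set.Iic n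

/-- The set of the indeterminates of `Fₙ`. -/
def FSet (r n : ℕ) : Set (Indet r) := kSet r n ∪ Set.range Indet.Z

/-- The set of the indeterminates of `Kₙ`. -/
def KSet (r n : ℕ) : Set (Indet r) := insert Indet.Y (FSet r n)

/-- The finite set of the indeterminates `Z`. -/
def ZFinset (r : ℕ) : Finset (Indet r) :=
  Finset.univ.map ⟨Indet.Z, fun _ _ h => Indet.Z.inj h⟩

theorem FSet_eq (n : ℕ) : FSet r n = kSet r n ∪ ZFinset r := by
  rw [FSet, ZFinset, Finset.coe_map, Finset.coe_univ, Set.image_univ]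
  rfl

theorem card_ZFinset : (ZFinset r).card = r - 1 := by
  simp [ZFinset]

/-- The field `kₙ` for the family `x`. -/
abbrev kAt (k₀ : Type*) {L : Type*} [Field k₀] [Field L] [Algebra k₀ L] {r : ℕ} (x : Indet r → L)
    (n : ℕ) : IntermediateField k₀ L :=
  kField k₀ (fun i => x (.X i)) n

/-- The field `Fₙ` for the family `x`. -/
abbrev FAt (k₀ : Type*) {L : Type*} [Field k₀] [Field L] [Algebra k₀ L] {r : ℕ} (x : Indet r → L)
    (n : ℕ) : IntermediateField k₀ L :=
  FField k₀ (fun i => x (.X i)) (fun i => x (.Z i)) n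

/-- The field `Kₙ` for the family `x`. -/
abbrev KAt (k₀ : Type*) {L : Type*} [Field k₀] [Field L] [Algebra k₀ L] {r : ℕ} (x : Indet r → L)
    (n : ℕ) : IntermediateField k₀ L :=
  gen k₀ x (KSet r n)

/-- The discrete valuation ring `Vₙ` for the family `x`. -/
abbrev VAt (k₀ : Type*) {L : Type*} [Field k₀] [Field L] [Algebra k₀ L] {r : ℕ} (x : Indet r → L)
    (n : ℕ) : Subring L :=
  VRing k₀ (fun i => x (.X i)) (fun i => x (.Z i)) (x .Y) n

/-- The local ring `Aₙ` for the family `x`. -/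
abbrev AAt (k₀ : Type*) {L : Type*} [Field k₀] [Field L] [Algebra k₀ L] {r : ℕ} (x : Indet r → L)
    (n : ℕ) : Subring L :=
  ARing k₀ (fun i => x (.X i)) (fun i => x (.Z i)) (x .Y) n

theorem kAt_eq (n : ℕ) : kAt k₀ x n = gen k₀ x (kSet r n) := by
  rw [gen, kSet, Set.image_image]
  rfl

theorem FAt_eq (n : ℕ) : FAt k₀ x n = gen k₀ x (FSet r n) := by
  rw [gen, FSet, kSet, Set.image_union, Set.image_image, ← Set.range_comp]
  rfl

theorem kSet_mono {n k : ℕ} (h : n ≤ k) : kSet r n ⊆ kSet r k :=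
  Set.image_mono (Set.Iic_subset_Iic.2 h)

theorem FSet_mono {n k : ℕ} (h : n ≤ k) : FSet r n ⊆ FSet r k :=
  Set.union_subset_union_left _ (kSet_mono h)

theorem KSet_mono {n k : ℕ} (h : n ≤ k) : KSet r n ⊆ KSet r k :=
  Set.insert_subset_insert (FSet_mono h)

theorem Y_notMem_FSet (n : ℕ) : Indet.Y ∉ FSet r n := by
  rintro (⟨i, -, h⟩ | ⟨i, h⟩) <;> cases h

theorem kAt_mono {n k : ℕ} (h : n ≤ k) : kAt k₀ x n ≤ kAt k₀ x k := by
  rw [kAt_eq, kAt_eq]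
  exact gen_mono (kSet_mono h)

theorem FAt_mono {n k : ℕ} (h : n ≤ k) : FAt k₀ x n ≤ FAt k₀ x k := by
  rw [FAt_eq, FAt_eq]
  exact gen_mono (FSet_mono h)

theorem kAt_le_FAt (n : ℕ) : kAt k₀ x n ≤ FAt k₀ x n := kField_le_FField _ _ _ n

theorem FAt_le_KAt (n : ℕ) : FAt k₀ x n ≤ KAt k₀ x n := by
  rw [FAt_eq]
  exact gen_mono (Set.subset_insert _ _)

theorem Y_mem_KAt (n : ℕ) : x .Y ∈ KAt k₀ x n := mem_gen (Set.mem_insert _ _)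

theorem mem_VAt_of_mem_FAt {n : ℕ} {c : L} (hc : c ∈ FAt k₀ x n) : c ∈ VAt k₀ x n :=
  ⟨C ⟨c, hc⟩, 1, by simp, by simp, by simp [aeval_C]⟩

theorem VAt_le_KAt (n : ℕ) {v : L} (hv : v ∈ VAt k₀ x n) : v ∈ KAt k₀ x n := by
  have h : ∀ p : (FAt k₀ x n)[X], aeval (x .Y) p ∈ KAt k₀ x n := fun p => by
    rw [aeval_eq_sum_range]
    exact sum_mem fun i _ => by
      rw [Algebra.smul_def]
      exact mul_mem (FAt_le_KAt n (p.coeff i).2) (pow_mem (Y_mem_KAt n) i)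
  obtain ⟨p, q, -, -, rfl⟩ := hv
  exact div_mem (h p) (h q)

theorem exists_polynomial_of_le {K K' : IntermediateField k₀ L} (h : K ≤ K') (t : L) (p : K[X]) :
    ∃ p' : K'[X], (∀ i, (p'.coeff i : L) = p.coeff i) ∧ aeval t p' = aeval t p := by
  have hι : (algebraMap K' L).comp (IntermediateField.inclusion h : K →+* K') = algebraMap K L :=
    RingHom.ext fun _ => rfl
  refine ⟨p.map (IntermediateField.inclusion h : K →+* K'), fun i => ?_, ?_⟩
  · rw [coeff_map]
    rfl
  · rw [aeval_def, eval₂_map, hι, aeval_def]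

theorem mem_VAt_iff {n : ℕ} {v : L} : v ∈ VAt k₀ x n ↔ ∃ p q : (FAt k₀ x n)[X],
    q.coeff 0 ≠ 0 ∧ aeval (x .Y) q ≠ 0 ∧ v = aeval (x .Y) p / aeval (x .Y) q := Iff.rfl

theorem VAt_mono : Monotone (VAt k₀ x) := by
  intro n k hnk v hv
  rw [mem_VAt_iff] at hv ⊢
  obtain ⟨p, q, h, h', rfl⟩ := hv
  obtain ⟨p', -, hp⟩ := exists_polynomial_of_le (FAt_mono hnk) (x .Y) p
  obtain ⟨q', hq0, hq⟩ := exists_polynomial_of_le (FAt_mono hnk) (x .Y) q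
  refine ⟨p', q', fun h0 => h (Subtype.ext ?_), by rwa [hq], by rw [hp, hq]⟩
  rw [← hq0, h0, ZeroMemClass.coe_zero, ZeroMemClass.coe_zero]

theorem AAt_mono : Monotone (AAt k₀ x) := by
  intro n k hnk
  rintro _ ⟨c, hc, v, hv, rfl⟩
  exact ⟨c, kAt_mono hnk hc, v, VAt_mono hnk hv, rfl⟩

theorem Y_mul_mem_AAt {n : ℕ} {v : L} (hv : v ∈ VAt k₀ x n) : x .Y * v ∈ AAt k₀ x n :=
  ⟨0, zero_mem _, v, hv, by simp⟩

theorem mem_AAt_of_mem_kAt {n : ℕ} {c : L} (hc : c ∈ kAt k₀ x n) : c ∈ AAt k₀ x n :=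
  ⟨c, hc, 0, zero_mem _, by simp⟩

theorem AAt_le_VAt (n : ℕ) : AAt k₀ x n ≤ VAt k₀ x n := by
  rintro _ ⟨c, hc, v, hv, rfl⟩
  exact add_mem (mem_VAt_of_mem_FAt (kAt_le_FAt n hc)) (mul_mem (Y_mem_VRing _ _ _ _ n) hv)

/-- The constant term at `Y = 0` of an element of `Vₙ`. -/
theorem exists_eq_add_Y_mul {n : ℕ} {v : L} (hv : v ∈ VAt k₀ x n) :
    ∃ c ∈ FAt k₀ x n, ∃ w ∈ VAt k₀ x n, v = c + x .Y * w := by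
  obtain ⟨p, q, hq, hq', rfl⟩ := hv
  let c := p.coeff 0 / q.coeff 0
  have hX : X ∣ p - C c * q := X_dvd_iff.2 (by simp [c, hq])
  obtain ⟨u, hu⟩ := hX
  refine ⟨c, c.2, aeval (x .Y) u / aeval (x .Y) q, ⟨u, q, hq, hq', rfl⟩, ?_⟩
  have := congrArg (aeval (x .Y)) hu
  rw [map_sub, map_mul, map_mul, aeval_X, aeval_C, IntermediateField.algebraMap_apply,
    sub_eq_iff_eq_add] at this
  rw [this]
  field_simp
  ring

theorem exists_pow_mul_mem_VAt {n : ℕ} {a : L} (ha : a ∈ KAt k₀ x n) :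
    ∃ N : ℕ, x .Y ^ N * a ∈ VAt k₀ x n := by
  rw [KAt, KSet, mem_gen_insert, ← FAt_eq] at ha
  obtain ⟨f, g, hg, rfl⟩ := ha
  have hg0 : g ≠ 0 := fun h => hg (by simp [h])
  obtain ⟨u, hu, hXu⟩ := exists_eq_pow_rootMultiplicity_mul_and_not_dvd g hg0 0
  rw [C_0, sub_zero] at hu hXu
  set N := rootMultiplicity 0 g
  have h1 : aeval (x .Y) g = x .Y ^ N * aeval (x .Y) u := by
    conv_lhs => rw [hu]
    rw [map_mul, map_pow, aeval_X]
  rw [h1] at hg ⊢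
  refine ⟨N, f, u, fun h => hXu (X_dvd_iff.2 h), right_ne_zero_of_mul hg, ?_⟩
  have := left_ne_zero_of_mul hg
  field_simp

variable (hx : AlgebraicIndependent k₀ x)

include hx

theorem transcendental_Y (n : ℕ) : Transcendental (FAt k₀ x n) (x .Y) := by
  rw [FAt_eq]
  exact transcendental_gen hx (Y_notMem_FSet n)

theorem Y_ne_zero : x .Y ≠ 0 := hx.ne_zero _

/-- The constant term at `Y = 0` is well defined. -/
theorem eq_zero_of_add_Y_mul_eq_zero {n : ℕ} {c v : L} (hc : c ∈ FAt k₀ x n) (hv : v ∈ VAt k₀ x n)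
    (h : c + x .Y * v = 0) : c = 0 := by
  obtain ⟨p, q, hq, hq', rfl⟩ := hv
  have h1 : aeval (x .Y) (C ⟨c, hc⟩ * q + X * p) = 0 := by
    rw [map_add, map_mul, map_mul, aeval_C, aeval_X, IntermediateField.algebraMap_apply]
    field_simp at h
    linear_combination h
  have h2 := congrArg (coeff · 0) (transcendental_iff.1 (transcendental_Y hx n) _ h1)
  simp only [coeff_add, coeff_C_mul, coeff_X_mul_zero, add_zero, coeff_zero, mul_eq_zero, hq,
    or_false] at h2
  exact congrArg Subtype.val h2

theorem one_add_Y_mul_ne_zero {n : ℕ} {v : L} (hv : v ∈ VAt k₀ x n) : 1 + x .Y * v ≠ 0 := fun h =>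
  one_ne_zero (eq_zero_of_add_Y_mul_eq_zero hx (one_mem _) hv h)

theorem inv_one_add_Y_mul_mem_VAt {n : ℕ} {v : L} (hv : v ∈ VAt k₀ x n) :
    (1 + x .Y * v)⁻¹ ∈ VAt k₀ x n := by
  have h0 := one_add_Y_mul_ne_zero hx hv
  obtain ⟨p, q, hq, hq', rfl⟩ := hv
  have h1 : aeval (x .Y) (q + X * p) =
      aeval (x .Y) q * (1 + x .Y * (aeval (x .Y) p / aeval (x .Y) q)) := by
    rw [map_add, map_mul, aeval_X]
    field_simp
  refine ⟨q, q + X * p, by simpa using hq, by rw [h1]; exact mul_ne_zero hq' h0, ?_⟩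
  rw [h1]
  field_simp

theorem inv_mem_AAt {n : ℕ} {c v : L} (hc : c ∈ kAt k₀ x n) (hc0 : c ≠ 0) (hv : v ∈ VAt k₀ x n) :
    c + x .Y * v ≠ 0 ∧ (c + x .Y * v)⁻¹ ∈ AAt k₀ x n := by
  have hc' : c⁻¹ ∈ VAt k₀ x n := mem_VAt_of_mem_FAt (kAt_le_FAt n (inv_mem hc))
  have hw : c⁻¹ * v ∈ VAt k₀ x n := mul_mem hc' hv
  have h0 := one_add_Y_mul_ne_zero hx hw
  have h1 := inv_one_add_Y_mul_mem_VAt hx hw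
  have h2 : c + x .Y * v = c * (1 + x .Y * (c⁻¹ * v)) := by field_simp
  rw [h2]
  refine ⟨mul_ne_zero hc0 h0, c⁻¹, inv_mem hc, -(c⁻¹ * (c⁻¹ * v) * (1 + x .Y * (c⁻¹ * v))⁻¹),
    neg_mem (mul_mem (mul_mem hc' hw) h1), ?_⟩
  set w := c⁻¹ * v
  field_simp
  ring

theorem inv_one_add_mem_AAt {n : ℕ} {v : L} (hv : v ∈ VAt k₀ x n) :
    (1 + x .Y * v)⁻¹ ∈ AAt k₀ x n :=
  (inv_mem_AAt hx (one_mem _) one_ne_zero hv).2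

/-- The local ring `Aₙ` has the maximal ideal `Y Vₙ`. -/
theorem inv_mem_AAt_of_notMem {n : ℕ} {a : L} (ha : a ∈ AAt k₀ x n)
    (h : ∀ v ∈ VAt k₀ x n, a ≠ x .Y * v) : a⁻¹ ∈ AAt k₀ x n := by
  obtain ⟨c, hc, v, hv, rfl⟩ := ha
  refine (inv_mem_AAt hx hc (fun h0 => h v hv ?_) hv).2
  rw [h0, zero_add]

/-- `Vₙ` is a valuation ring of `Kₙ` with the maximal ideal `Y Vₙ`. -/
theorem mem_VAt_or_inv {n : ℕ} {a : L} (ha : a ∈ KAt k₀ x n) :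
    a ∈ VAt k₀ x n ∨ ∃ v ∈ VAt k₀ x n, a⁻¹ = x .Y * v := by
  classical
  have hex := exists_pow_mul_mem_VAt ha
  have hN := Nat.find_spec hex
  have hmin := fun k => Nat.find_min (H := hex) (m := k)
  set N := Nat.find hex
  rcases hN' : N with _ | M
  · left
    simpa [hN'] using hN
  · right
    rw [hN'] at hN
    obtain ⟨c, hc, w, hw, hcw⟩ := exists_eq_add_Y_mul hN
    have hc0 : c ≠ 0 := by
      rintro rfl
      refine hmin M (by lia) ?_
      have : x .Y * (x .Y ^ M * a) = x .Y * w := by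
        rw [← mul_assoc, ← pow_succ', hcw, zero_add]
      rwa [mul_left_cancel₀ (Y_ne_zero hx) this]
    have hw' : c⁻¹ * w ∈ VAt k₀ x n := mul_mem (mem_VAt_of_mem_FAt (inv_mem hc)) hw
    have h1 := inv_one_add_Y_mul_mem_VAt hx hw'
    have h0 := one_add_Y_mul_ne_zero hx hw'
    refine ⟨x .Y ^ M * (c⁻¹ * (1 + x .Y * (c⁻¹ * w))⁻¹),
      mul_mem (pow_mem (Y_mem_VRing _ _ _ _ n) M)
        (mul_mem (mem_VAt_of_mem_FAt (inv_mem hc)) h1), ?_⟩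
    have h2 : x .Y ^ (M + 1) * a = c * (1 + x .Y * (c⁻¹ * w)) := by
      rw [hcw]
      field_simp
    have h3 : a ≠ 0 := by
      rintro rfl
      rw [mul_zero] at h2
      exact mul_ne_zero hc0 h0 h2.symm
    rw [← mul_inv, ← h2]
    have := Y_ne_zero hx
    field_simp
    rw [pow_succ']

/-- Composites of `Vₙ` with valuation rings of `Fₙ`. -/
theorem exists_composite_VAt (n : ℕ) (W₀ : ValuationSubring (FAt k₀ x n)) :
    ∃ W : ValuationSubring L, (∀ a : FAt k₀ x n, (a : L) ∈ W ↔ a ∈ W₀) ∧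
      ∀ v ∈ VAt k₀ x n, W.valuation (x .Y * v) < 1 := by
  obtain ⟨W, hW, h⟩ := exists_composite W₀ (transcendental_Y hx n)
  refine ⟨W, hW, ?_⟩
  have hY : W.valuation (x .Y) < 1 := by simpa using h 1
  have hp : ∀ p : (FAt k₀ x n)[X], W.valuation (x .Y * aeval (x .Y) p) < 1 := fun p => by
    rw [aeval_eq_sum_range, Finset.mul_sum]
    refine W.valuation.map_sum_lt one_ne_zero fun i _ => ?_
    rw [Algebra.smul_def, mul_left_comm, ← mul_assoc, mul_comm _ (x .Y), mul_comm (x .Y), map_mul,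
      map_pow]
    exact (mul_le_of_le_one_right' (pow_le_one' hY.le i)).trans_lt (h _)
  rintro _ ⟨p, q, hq, hq', rfl⟩
  have h1 : W.valuation (1 + x .Y * aeval (x .Y) (C (q.coeff 0)⁻¹ * q.divX)) = 1 := by
    rw [W.valuation.map_add_eq_of_lt_left (by rw [map_one]; exact hp _), map_one]
  have h2 : aeval (x .Y) q =
      (q.coeff 0 : L) * (1 + x .Y * aeval (x .Y) (C (q.coeff 0)⁻¹ * q.divX)) := by
    conv_lhs => rw [← divX_mul_X_add q]
    rw [map_add, map_mul, map_mul, aeval_X, aeval_C, aeval_C, IntermediateField.algebraMap_apply,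
      IntermediateField.algebraMap_apply, IntermediateField.coe_inv]
    have : (q.coeff 0 : L) ≠ 0 := fun h => hq (Subtype.ext h)
    field_simp
    ring
  have h3 := hp (C (q.coeff 0)⁻¹ * p)
  rw [h2, mul_div_assoc', map_div₀, map_mul _ (q.coeff 0 : L), h1, mul_one, ← map_div₀]
  convert h3 using 2
  rw [map_mul, aeval_C, IntermediateField.algebraMap_apply, IntermediateField.coe_inv]
  field_simp

end Local

section Local

variable {k₀ L : Type*} [Field k₀] [Field L] [Algebra k₀ L] {r : ℕ} {x : Indet r → L}
  (hx : AlgebraicIndependent k₀ x)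

include hx

theorem mem_kAt_of_isAlgebraic {n : ℕ} {a : L} (ha : a ∈ FAt k₀ x n)
    (h : IsAlgebraic (kAt k₀ x n) a) : a ∈ kAt k₀ x n := by
  rw [kAt_eq] at h ⊢
  rw [FAt_eq, FSet_eq] at ha
  exact mem_gen_of_isAlgebraic hx _ ha h

/-- `Aₙ` is an intersection of valuation rings of `Kₙ`, because `kₙ` is algebraically closed in
`Fₙ`. -/
theorem exists_valuationSubring_of_notMem_AAt {n : ℕ} {a : L} (ha : a ∈ KAt k₀ x n)
    (ha' : a ∉ AAt k₀ x n) :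
    ∃ W : ValuationSubring L, AAt k₀ x n ≤ W.toSubring ∧ a ∉ W := by
  rcases mem_VAt_or_inv hx ha with hV | ⟨v, hv, hav⟩
  · obtain ⟨f, hf, w, hw, rfl⟩ := exists_eq_add_Y_mul hV
    have hfk : f ∉ kAt k₀ x n := fun h => ha' ⟨f, h, w, hw, rfl⟩
    have hft : Transcendental (kAt k₀ x n) f⁻¹ := fun h =>
      hfk (mem_kAt_of_isAlgebraic hx hf (by simpa using h.inv))
    have := (Ideal.span_singleton_prime X_ne_zero).2 (Polynomial.prime_X (R := kAt k₀ x n))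
    obtain ⟨W₁, hW₁⟩ := exists_valuationSubring_center
      (aeval f⁻¹ : (kAt k₀ x n)[X] →ₐ[kAt k₀ x n] L).toRingHom
      (transcendental_iff_injective.1 hft) (Ideal.span {X})
    -- a composite of `Vₙ` with a valuation ring of `Fₙ` which contains `kₙ` but not `f`
    obtain ⟨W, hW, hYW⟩ := exists_composite_VAt hx n (W₁.comap (algebraMap (FAt k₀ x n) L))
    have h1 : ∀ c (hc : c ∈ FAt k₀ x n), c ∈ W ↔ c ∈ W₁ := fun c hc => hW ⟨c, hc⟩
    have hfW : f ∉ W := by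
      rw [h1 f hf]
      have h2 := (hW₁ X).2.2 (Ideal.mem_span_singleton_self _)
      have h3 : W₁.valuation f⁻¹ < 1 := by simpa using h2
      rw [← ValuationSubring.mem_nonunits_iff, ValuationSubring.inv_mem_nonunits_iff] at h3
      exact h3.resolve_left fun h0 => hfk (h0 ▸ zero_mem _)
    refine ⟨W, ?_, fun h => hfW ?_⟩
    · rintro _ ⟨c, hc, v, hv, rfl⟩
      refine W.add_mem _ _ ?_ ((W.valuation_le_one_iff _).1 (hYW v hv).le)
      rw [h1 c (kAt_le_FAt n hc)]
      simpa using (hW₁ (C ⟨c, hc⟩)).1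
    · have := sub_mem h ((W.valuation_le_one_iff _).1 (hYW w hw).le)
      rwa [add_sub_cancel_right] at this
  · obtain ⟨W, hW, hYW⟩ := exists_composite_VAt hx n ⊤
    -- the trivial valuation ring of `Fₙ` gives `Vₙ` itself
    refine ⟨W, ?_, ?_⟩
    · rintro _ ⟨c, hc, v, hv, rfl⟩
      exact W.add_mem _ _ ((hW ⟨c, kAt_le_FAt n hc⟩).2 (ValuationSubring.mem_top _))
        ((W.valuation_le_one_iff _).1 (hYW v hv).le)
    · have h2 := hYW v hv
      rw [← hav, ← ValuationSubring.mem_nonunits_iff, ValuationSubring.inv_mem_nonunits_iff] at h2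
      exact h2.resolve_left fun h0 => ha' (h0 ▸ zero_mem _)

end Local

/-! ### The rings `Dₙ` -/

section Sequence

variable {k₀ L : Type*} [Field k₀] [Field L] [Algebra k₀ L] {r : ℕ} {x : Indet r → L}

/-- The element `Xₙ'` for the family `x`. -/
abbrev tAt {L : Type*} [Field L] {r : ℕ} (x : Indet r → L) (n : ℕ) : L :=
  X' (fun i => x (.X i)) (x .Y) n

/-- The ring `Dₙ` for the family `x`. -/
abbrev DAt (k₀ : Type*) {L : Type*} [Field k₀] [Field L] [Algebra k₀ L] {r : ℕ} (x : Indet r → L)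
    (n : ℕ) : Subring L :=
  DRing k₀ (fun i => x (.X i)) (fun i => x (.Z i)) (x .Y) n

theorem algebraMap_subring_apply {R : Subring L} (a : R) : algebraMap R L a = a := rfl

theorem X_mem_FAt (n : ℕ) : x (.X n) ∈ FAt k₀ x n := by
  rw [FAt_eq]
  exact mem_gen (Or.inl ⟨n, Set.mem_Iic.2 le_rfl, rfl⟩)

theorem DAt_le_AAt (n : ℕ) : DAt k₀ x n ≤ AAt k₀ x n := by
  cases n with
  | zero => exact le_rfl
  | succ n => exact inf_le_right

theorem DAt_le_KAt (n : ℕ) {a : L} (ha : a ∈ DAt k₀ x n) : a ∈ KAt k₀ x n :=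
  VAt_le_KAt n (AAt_le_VAt n (DAt_le_AAt n ha))

theorem mem_DAt_succ {n : ℕ} {a : L} : a ∈ DAt k₀ x (n + 1) ↔
    a ∈ kronecker (DAt k₀ x n) (tAt x (n + 1)) ∧ a ∈ AAt k₀ x (n + 1) := Iff.rfl

theorem DAt_mono : Monotone (DAt k₀ x) := by
  refine monotone_nat_of_le_succ fun n a ha => mem_DAt_succ.2 ⟨?_, ?_⟩
  · exact algebraMap_mem_kronecker (R := DAt k₀ x n) _ ⟨a, ha⟩
  · exact AAt_mono n.le_succ (DAt_le_AAt n ha)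

variable (hx : AlgebraicIndependent k₀ x)

include hx

theorem tAt_eq (n : ℕ) : tAt x n = (x .Y)⁻¹ + x (.X n) := by
  have := Y_ne_zero hx
  rw [tAt, X']
  field_simp

theorem tAt_mem_KAt (n : ℕ) : tAt x n ∈ KAt k₀ x n := by
  rw [tAt_eq hx]
  exact add_mem (inv_mem (Y_mem_KAt n)) (FAt_le_KAt n (X_mem_FAt n))

theorem inv_tAt (n : ℕ) : ∃ v ∈ VAt k₀ x n, (tAt x n)⁻¹ = x .Y * v :=
  ⟨_, inv_one_add_Y_mul_mem_VAt hx (mem_VAt_of_mem_FAt (X_mem_FAt n)), by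
    rw [tAt, X', inv_div, div_eq_mul_inv]⟩

theorem tAt_ne_zero (n : ℕ) : tAt x n ≠ 0 :=
  div_ne_zero (one_add_Y_mul_ne_zero hx (mem_VAt_of_mem_FAt (X_mem_FAt n))) (Y_ne_zero hx)

theorem inv_tAt_mem_AAt (n : ℕ) : (tAt x n)⁻¹ ∈ AAt k₀ x n := by
  obtain ⟨v, hv, h⟩ := inv_tAt hx n
  exact h ▸ Y_mul_mem_AAt hv

theorem exists_mul_inv_pow_eq {n : ℕ} {a : L} (ha : a ∈ KAt k₀ x n) :
    ∃ M : ℕ, ∀ N ≥ M, ∃ v ∈ VAt k₀ x n, a * (tAt x n)⁻¹ ^ N = x .Y * v := by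
  obtain ⟨M, hM⟩ := exists_pow_mul_mem_VAt ha
  obtain ⟨u, hu, hut⟩ := inv_tAt hx n
  refine ⟨M + 1, fun N hN => ⟨x .Y ^ M * a * (x .Y ^ (N - 1 - M) * u ^ N), mul_mem hM
    (mul_mem (pow_mem (Y_mem_VRing _ _ _ _ n) _) (pow_mem hu N)), ?_⟩⟩
  obtain ⟨j, rfl⟩ := Nat.exists_eq_add_of_le hN
  rw [hut, show M + 1 + j - 1 - M = j by lia]
  ring

theorem transcendental_tAt_KAt (n : ℕ) : Transcendental (KAt k₀ x n) (tAt x (n + 1)) := by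
  have hX : Indet.X (n + 1) ∉ KSet r n := by
    rintro (h | ⟨i, hi, h⟩ | ⟨i, h⟩)
    · cases h
    · cases h
      exact absurd hi (by simp)
    · cases h
  intro h
  refine transcendental_gen hx hX ?_
  have h1 := h.sub (isAlgebraic_algebraMap (⟨_, inv_mem (Y_mem_KAt n)⟩ : KAt k₀ x n))
  rw [tAt_eq hx] at h1
  simpa using h1

theorem mem_adjoin_tAt {n : ℕ} {a : L} (ha : a ∈ KAt k₀ x (n + 1)) :
    a ∈ IntermediateField.adjoin (KAt k₀ x n) {tAt x (n + 1)} := by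
  have hS : KSet r (n + 1) = KSet r n ∪ {Indet.X (n + 1)} := by
    have : Set.Iic (n + 1) = Set.Iic n ∪ {n + 1} := by
      ext i
      simp only [Set.mem_Iic, Set.union_singleton, Set.mem_insert_iff]
      lia
    rw [KSet, KSet, FSet, FSet, kSet, kSet, this, Set.image_union, Set.image_singleton,
      Set.insert_union, Set.union_right_comm]
  rw [KAt, hS, mem_gen_union, Set.image_singleton] at ha
  refine (IntermediateField.adjoin_simple_le_iff.2 ?_) ha
  have h1 : x (.X (n + 1)) = tAt x (n + 1) - (x .Y)⁻¹ := by
    rw [tAt_eq hx]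
    ring
  rw [h1]
  exact sub_mem (IntermediateField.mem_adjoin_simple_self _ _)
    (inv_mem (IntermediateField.algebraMap_mem _ (⟨_, Y_mem_KAt n⟩ : KAt k₀ x n)))

omit hx in
theorem transcendental_of_le {K : IntermediateField k₀ L} {R : Subring L} (h : ∀ a ∈ R, a ∈ K)
    {t : L} (ht : Transcendental K t) : Transcendental R t := by
  let ι : R →+* K := Subring.inclusion (T := K.toSubring) h
  rw [transcendental_iff] at ht ⊢
  intro p hp
  have h1 : (algebraMap K L).comp ι = algebraMap R L := RingHom.ext fun _ => rfl
  have h2 := ht (p.map ι) (by rw [aeval_def, eval₂_map, h1, ← aeval_def, hp])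
  refine (Polynomial.map_eq_zero_iff ?_).1 h2
  intro a b hab
  exact Subtype.ext (congrArg (algebraMap K L) hab)

theorem transcendental_tAt (n : ℕ) : Transcendental (DAt k₀ x n) (tAt x (n + 1)) :=
  transcendental_of_le (fun _ => DAt_le_KAt n) (transcendental_tAt_KAt hx n)

omit hx in
theorem exists_common_denominator {K : IntermediateField k₀ L} {R : Subring L}
    (h : ∀ a ∈ K, ∃ b ∈ R, ∃ c ∈ R, c ≠ 0 ∧ a = b / c) (t : L) (f : K[X]) :
    ∃ d : R, (d : L) ≠ 0 ∧ ∃ p : R[X], aeval t p = d * aeval t f := by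
  induction f using Polynomial.induction_on' with
  | add f g hf hg =>
    obtain ⟨d, hd, p, hp⟩ := hf
    obtain ⟨e, he, q, hq⟩ := hg
    refine ⟨d * e, mul_ne_zero hd he, C e * p + C d * q, ?_⟩
    simp only [map_add, map_mul, aeval_C, hp, hq, Subring.coe_mul]
    simp only [algebraMap_subring_apply]
    ring
  | monomial n a =>
    obtain ⟨b, hb, c, hc, hc0, ha⟩ := h a a.2
    refine ⟨⟨c, hc⟩, hc0, monomial n ⟨b, hb⟩, ?_⟩
    simp only [aeval_monomial, algebraMap_subring_apply, IntermediateField.algebraMap_apply,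
      ha]
    field_simp

/-- Every element of the field `Kₙ₊₁` is a fraction of polynomials in `Xₙ₊₁'` over `Dₙ`, and the
quotient field of `Dₙ` is `Kₙ`. -/
theorem exists_fraction (n : ℕ) :
    (∀ a ∈ KAt k₀ x n, ∃ b ∈ DAt k₀ x n, ∃ c ∈ DAt k₀ x n, c ≠ 0 ∧ a = b / c) ∧
    ∀ a ∈ KAt k₀ x (n + 1), ∃ f g : (DAt k₀ x n)[X], aeval (tAt x (n + 1)) g ≠ 0 ∧
      a = aeval (tAt x (n + 1)) f / aeval (tAt x (n + 1)) g := by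
  have key : ∀ n, (∀ a ∈ KAt k₀ x n, ∃ b ∈ DAt k₀ x n, ∃ c ∈ DAt k₀ x n, c ≠ 0 ∧ a = b / c) →
      ∀ a ∈ KAt k₀ x (n + 1), ∃ f g : (DAt k₀ x n)[X], aeval (tAt x (n + 1)) g ≠ 0 ∧
      a = aeval (tAt x (n + 1)) f / aeval (tAt x (n + 1)) g := by
    intro n hn a ha
    obtain ⟨f, g, hg, rfl⟩ := mem_adjoin_simple_iff'.1 (mem_adjoin_tAt hx ha)
    obtain ⟨d, hd, p, hp⟩ := exists_common_denominator hn (tAt x (n + 1)) f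
    obtain ⟨e, he, q, hq⟩ := exists_common_denominator hn (tAt x (n + 1)) g
    refine ⟨C e * p, C d * q, ?_, ?_⟩
    · rw [map_mul, aeval_C, hq, algebraMap_subring_apply]
      exact mul_ne_zero hd (mul_ne_zero he hg)
    · rw [map_mul, map_mul, aeval_C, aeval_C, hp, hq, algebraMap_subring_apply,
        algebraMap_subring_apply]
      field_simp
  suffices h : ∀ a ∈ KAt k₀ x n, ∃ b ∈ DAt k₀ x n, ∃ c ∈ DAt k₀ x n, c ≠ 0 ∧ a = b / c from
    ⟨h, key n h⟩
  induction n with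
  | zero =>
    intro a ha
    obtain ⟨N, hN⟩ := exists_pow_mul_mem_VAt ha
    have hY := Y_ne_zero hx
    refine ⟨x .Y * (x .Y ^ N * a), Y_mul_mem_AAt hN, x .Y * x .Y ^ N,
      Y_mul_mem_AAt (pow_mem (Y_mem_VRing _ _ _ _ 0) N), mul_ne_zero hY (pow_ne_zero _ hY), ?_⟩
    field_simp
  | succ n ih =>
    intro a ha
    obtain ⟨f, g, hg, hfg⟩ := key n ih a ha
    obtain ⟨M, hM⟩ := exists_mul_inv_pow_eq hx ha
    obtain ⟨h0, h1, h2⟩ := exists_denominator (transcendental_tAt hx n) hg hfg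
      (show f.natDegree < max M (f.natDegree + 1) by lia)
    set N := max M (f.natDegree + 1)
    obtain ⟨v, hv, hav⟩ := hM N (le_max_left _ _)
    have ht := tAt_ne_zero hx (n + 1)
    have h3 : (1 + a * (tAt x (n + 1))⁻¹ ^ N)⁻¹ ∈ AAt k₀ x (n + 1) := by
      rw [hav]
      exact inv_one_add_mem_AAt hx hv
    have h4 := inv_pow_mem_kronecker (R := DAt k₀ x n) ht N
    refine ⟨(1 + a * (tAt x (n + 1))⁻¹ ^ N)⁻¹ * a * (tAt x (n + 1))⁻¹ ^ N,
      ⟨mul_mem h2 h4, ?_⟩, (1 + a * (tAt x (n + 1))⁻¹ ^ N)⁻¹ * (tAt x (n + 1))⁻¹ ^ N,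
      ⟨mul_mem h1 h4, mul_mem h3 (pow_mem (inv_tAt_mem_AAt hx _) N)⟩, ?_, ?_⟩
    · rw [mul_assoc]
      exact mul_mem h3 (hav ▸ Y_mul_mem_AAt hv)
    · exact mul_ne_zero (inv_ne_zero h0) (pow_ne_zero _ (inv_ne_zero ht))
    · have h5 := pow_ne_zero N (inv_ne_zero ht)
      rw [mul_right_comm, mul_div_cancel_left₀ _ (mul_ne_zero (inv_ne_zero h0) h5)]

theorem mem_KAt_of_mem_kronecker {n : ℕ} {b : L}
    (hb : b ∈ kronecker (DAt k₀ x n) (tAt x (n + 1))) : b ∈ KAt k₀ x (n + 1) := by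
  have h : ∀ p : (DAt k₀ x n)[X], aeval (tAt x (n + 1)) p ∈ KAt k₀ x (n + 1) := fun p => by
    rw [aeval_eq_sum_range]
    exact sum_mem fun i _ => by
      rw [Algebra.smul_def]
      exact mul_mem (DAt_le_KAt _ (DAt_mono n.le_succ (p.coeff i).2))
        (pow_mem (tAt_mem_KAt hx _) i)
  obtain ⟨f, g, -, -, rfl⟩ := hb
  exact div_mem (h f) (h g)

/-- The Kronecker function ring `Bₙ₊₁` is the localization of `Dₙ₊₁` at the powers of
`1 / Xₙ₊₁'`. -/
theorem exists_mul_inv_pow_mem_DAt {n : ℕ} {b : L}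
    (hb : b ∈ kronecker (DAt k₀ x n) (tAt x (n + 1))) :
    ∃ M : ℕ, ∀ N ≥ M, b * (tAt x (n + 1))⁻¹ ^ N ∈ DAt k₀ x (n + 1) := by
  obtain ⟨M, hM⟩ := exists_mul_inv_pow_eq hx (mem_KAt_of_mem_kronecker hx hb)
  refine ⟨M, fun N hN => ⟨mul_mem hb (inv_pow_mem_kronecker (tAt_ne_zero hx _) N), ?_⟩⟩
  obtain ⟨v, hv, h⟩ := hM N hN
  exact h ▸ Y_mul_mem_AAt hv

theorem inv_tAt_mem_DAt (n : ℕ) : (tAt x (n + 1))⁻¹ ∈ DAt k₀ x (n + 1) :=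
  ⟨by simpa using inv_pow_mem_kronecker (R := DAt k₀ x n) (tAt_ne_zero hx (n + 1)) 1,
    inv_tAt_mem_AAt hx _⟩

/-- `Aₙ₊₁` is a localization of `Dₙ₊₁` at elements congruent to `1` modulo `1 / Xₙ₊₁'`. -/
theorem exists_mul_mem_DAt {n : ℕ} {a : L} (ha : a ∈ AAt k₀ x (n + 1)) :
    ∃ s ∈ DAt k₀ x (n + 1), s * a ∈ DAt k₀ x (n + 1) ∧
      (1 - s) * tAt x (n + 1) ∈ DAt k₀ x (n + 1) := by
  obtain ⟨f, g, hg, hfg⟩ := (exists_fraction hx n).2 a (VAt_le_KAt _ (AAt_le_VAt _ ha))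
  obtain ⟨h0, h1, h2⟩ := exists_denominator (transcendental_tAt hx n) hg hfg
    (show f.natDegree < f.natDegree + 2 by lia)
  set N := f.natDegree + 1 with hN
  set t := tAt x (n + 1)
  rw [show f.natDegree + 2 = N + 1 from rfl] at h0 h1 h2
  have ht : t ≠ 0 := tAt_ne_zero hx (n + 1)
  have htA : t⁻¹ ∈ AAt k₀ x (n + 1) := inv_tAt_mem_AAt hx (n + 1)
  obtain ⟨u, hu, htu⟩ := inv_tAt hx (n + 1)
  have h3 : (1 + a * t⁻¹ ^ (N + 1))⁻¹ ∈ AAt k₀ x (n + 1) := by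
    have : a * t⁻¹ ^ (N + 1) = x .Y * (a * t⁻¹ ^ N * u) := by
      rw [pow_succ, show t⁻¹ = x .Y * u from htu]
      ring
    rw [this]
    exact inv_one_add_mem_AAt hx (mul_mem (AAt_le_VAt _ (mul_mem ha (pow_mem htA N))) hu)
  refine ⟨_, ⟨h1, h3⟩, ⟨h2, mul_mem h3 ha⟩, ?_⟩
  have h4 : (1 - (1 + a * t⁻¹ ^ (N + 1))⁻¹) * t = (1 + a * t⁻¹ ^ (N + 1))⁻¹ * a * t⁻¹ ^ N := by
    have h5 : (1 + a * t⁻¹ ^ (N + 1)) * t = t + a * t⁻¹ ^ N := by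
      rw [pow_succ, add_mul, one_mul, mul_assoc, mul_assoc, inv_mul_cancel₀ ht, mul_one]
    generalize 1 + a * t⁻¹ ^ (N + 1) = u at h0 h5
    generalize t⁻¹ ^ N = q at h5
    field_simp
    linear_combination h5
  rw [h4]
  exact ⟨mul_mem h2 (inv_pow_mem_kronecker ht N), mul_mem (mul_mem h3 ha) (pow_mem htA N)⟩

/-- `Dₙ` is an intersection of valuation rings of `Kₙ`. -/
theorem exists_valuationSubring_of_notMem_DAt {n : ℕ} {a : L} (ha : a ∈ KAt k₀ x n)
    (ha' : a ∉ DAt k₀ x n) :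
    ∃ W : ValuationSubring L, DAt k₀ x n ≤ W.toSubring ∧ a ∉ W := by
  by_cases hA : a ∈ AAt k₀ x n
  · cases n with
    | zero => exact absurd hA ha'
    | succ n =>
      obtain ⟨f, g, hg, rfl⟩ := (exists_fraction hx n).2 a ha
      obtain ⟨W, hW, hG, h⟩ := exists_isGauss_notMem_of_notMem_kronecker
        (transcendental_tAt hx n) hg fun h => ha' ⟨h, hA⟩
      exact ⟨W, inf_le_left.trans (kronecker_le_of_isGauss hW hG), h⟩
  · obtain ⟨W, hW, h⟩ := exists_valuationSubring_of_notMem_AAt hx ha hA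
    exact ⟨W, (DAt_le_AAt n).trans hW, h⟩

/-- A valuation ring containing `Dₙ₊₁` contains one of the two rings whose intersection is
`Dₙ₊₁`. -/
theorem tAt_mem_or_AAt_le {n : ℕ} {W : ValuationSubring L} (hW : DAt k₀ x (n + 1) ≤ W.toSubring) :
    tAt x (n + 1) ∈ W ∨ AAt k₀ x (n + 1) ≤ W.toSubring := by
  by_cases ht : tAt x (n + 1) ∈ W
  · exact Or.inl ht
  refine Or.inr fun a ha => ?_
  obtain ⟨s, hs, hsa, h⟩ := exists_mul_mem_DAt hx ha
  have h1 : W.valuation (1 - s) < 1 := by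
    have h2 := (W.valuation_le_one_iff _).2 (hW h)
    by_contra! h3
    rw [map_mul] at h2
    exact ht ((W.valuation_le_one_iff _).1 ((le_mul_of_one_le_left' h3).trans h2))
  have h2 : W.valuation s = 1 := by
    have := W.valuation.map_sub_eq_of_lt_right (x := 1 - s) (y := 1) (by rwa [map_one])
    rwa [sub_sub_cancel_left, Valuation.map_neg, map_one] at this
  have h3 := (W.valuation_le_one_iff _).2 (hW hsa)
  rw [map_mul, h2, one_mul] at h3
  exact (W.valuation_le_one_iff _).1 h3

theorem kronecker_le_of_tAt_mem {n : ℕ} {W : ValuationSubring L}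
    (hW : DAt k₀ x (n + 1) ≤ W.toSubring) (ht : tAt x (n + 1) ∈ W) :
    kronecker (DAt k₀ x n) (tAt x (n + 1)) ≤ W.toSubring := by
  intro b hb
  obtain ⟨M, hM⟩ := exists_mul_inv_pow_mem_DAt hx hb
  have h1 := W.mul_mem _ _ (hW (hM M le_rfl)) (pow_mem ht M)
  rwa [mul_assoc, ← mul_pow, inv_mul_cancel₀ (tAt_ne_zero hx _), one_pow, mul_one] at h1

end Sequence

/-! ### Localizations, essential domains and dimensions -/

section Localization

variable {L : Type*} [Field L] {D : Subring L} {W : ValuationSubring L}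

theorem isLocalization_atPrime_of_injective {R B : Type*} [CommRing R] [CommRing B] [Algebra R B]
    (p : Ideal R) [p.IsPrime] (hinj : Function.Injective (algebraMap R B))
    (hu : ∀ d ∉ p, IsUnit (algebraMap R B d))
    (hs : ∀ b : B, ∃ c d : R, d ∉ p ∧ b * algebraMap R B d = algebraMap R B c) :
    IsLocalization.AtPrime B p where
  map_units d := hu d d.2
  surj b := by
    obtain ⟨c, d, hd, h⟩ := hs b
    exact ⟨(c, ⟨d, hd⟩), h⟩
  exists_of_eq h := ⟨1, by rw [hinj h]⟩

/-- A ring `B` above `A` is the localization of `A` at a prime `p` if it inverts the elements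
outside of `p`, and the elements of `B` have denominators congruent to `1` modulo `p`. -/
theorem isLocalization_atPrime_of_subring_le {A B : Subring L} (hAB : A ≤ B) (p : Ideal A)
    [p.IsPrime] (hu : ∀ d ∉ p, (d : L)⁻¹ ∈ B)
    (hs : ∀ b ∈ B, ∃ s ∈ A, s * b ∈ A ∧ ∃ h : 1 - s ∈ A, (⟨1 - s, h⟩ : A) ∈ p) :
    letI := (Subring.inclusion hAB).toAlgebra
    IsLocalization.AtPrime B p := by
  let := (Subring.inclusion hAB).toAlgebra
  refine isLocalization_atPrime_of_injective _ (Subring.inclusion_injective _) (fun d hd => ?_)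
    fun b => ?_
  · have hd0 : (d : L) ≠ 0 := fun h0 => hd (by
      rw [show d = 0 from Subtype.ext h0]
      exact zero_mem p)
    exact IsUnit.of_mul_eq_one (⟨_, hu d hd⟩ : B) (Subtype.ext (mul_inv_cancel₀ hd0))
  · obtain ⟨s, hsA, hsb, h, hp⟩ := hs b b.2
    refine ⟨⟨_, hsb⟩, ⟨s, hsA⟩, fun hsp => ?_, Subtype.ext (mul_comm _ _)⟩
    refine Ideal.IsPrime.ne_top ‹_› ((Ideal.eq_top_iff_one p).2 ?_)
    rw [show (1 : A) = ⟨1 - s, h⟩ + ⟨s, hsA⟩ from Subtype.ext (sub_add_cancel _ _).symm]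
    exact add_mem hp hsp

/-- The inclusion of a subring into a valuation ring. -/
abbrev toValuationSubring (h : D ≤ W.toSubring) : D →+* W := D.subtype.codRestrict W fun a => h a.2

/-- The center on `D` of a valuation ring containing `D`. -/
abbrev center (h : D ≤ W.toSubring) : Ideal D :=
  (IsLocalRing.maximalIdeal W).comap (toValuationSubring h)

theorem mem_center {h : D ≤ W.toSubring} {d : D} : d ∈ center h ↔ W.valuation d < 1 := by
  rw [center, Ideal.mem_comap, ValuationSubring.valuation_lt_one_iff]
  rfl

/-- Every element of `W` is a fraction of elements of `D` with a denominator that is a unit of `W`: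
`W` is a localization of `D`. -/
def IsFractional (D : Subring L) (W : ValuationSubring L) : Prop :=
  ∀ a ∈ W, ∃ b ∈ D, ∃ c ∈ D, W.valuation c = 1 ∧ a = b / c

theorem IsFractional.isLocalization (hW : IsFractional D W) (h : D ≤ W.toSubring) :
    letI := (toValuationSubring h).toAlgebra
    IsLocalization.AtPrime W (center h) := by
  let := (toValuationSubring h).toAlgebra
  refine isLocalization_atPrime_of_injective _ (fun a b hab => Subtype.ext (congrArg
    (fun w : W => (w : L)) hab)) (fun d hd => ?_) (fun b => ?_)
  · rw [mem_center, not_lt] at hd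
    rw [ValuationSubring.valuation_eq_one_iff]
    exact le_antisymm (W.valuation_le_one _) hd
  · obtain ⟨c, hc, d, hd, hd1, hb⟩ := hW b b.2
    refine ⟨⟨c, hc⟩, ⟨d, hd⟩, ?_, Subtype.ext ?_⟩
    · rw [mem_center]
      exact hd1.not_lt
    · have hd0 : d ≠ 0 := by
        rintro rfl
        simp at hd1
      change (b : L) * d = c
      rw [hb]
      field_simp

theorem IsFractional.valuationRing_localization (hW : IsFractional D W) (h : D ≤ W.toSubring) :
    ValuationRing (Localization.AtPrime (center h)) := by
  let := (toValuationSubring h).toAlgebra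
  have := hW.isLocalization h
  let e := IsLocalization.algEquiv (center h).primeCompl W (Localization.AtPrime (center h))
  rw [ValuationRing.iff_dvd_total]
  refine ⟨fun a b => ?_⟩
  have h1 := ValuationRing.dvd_total (e.symm a) (e.symm b)
  rwa [map_dvd_iff, map_dvd_iff] at h1

theorem IsFractional.ringKrullDim_le (hW : IsFractional D W) (h : D ≤ W.toSubring) :
    ringKrullDim W ≤ ringKrullDim D := by
  let := (toValuationSubring h).toAlgebra
  have := hW.isLocalization h
  rw [IsLocalization.AtPrime.ringKrullDim_eq_height (center h)]
  exact Ideal.height_le_ringKrullDim_of_isPrime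

/-- A subring of a field with the field as quotient field, which is an intersection of valuation
rings that are localizations of it, is essential. -/
theorem isEssential_of_isFractional [IsFractionRing D L]
    (h : ∀ a ∉ D, ∃ W : ValuationSubring L, D ≤ W.toSubring ∧ IsFractional D W ∧ a ∉ W) :
    IsEssential D := by
  refine ⟨{p | ValuationRing (Localization.AtPrime p.asIdeal)}, fun p hp => hp, ?_⟩
  rw [eq_bot_iff]
  intro y hy
  let φ := FractionRing.algEquiv D L
  by_cases hyD : φ y ∈ D
  · rw [Algebra.mem_bot]
    refine ⟨⟨φ y, hyD⟩, φ.injective ?_⟩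
    rw [φ.commutes]
    rfl
  obtain ⟨W, hDW, hW, hyW⟩ := h _ hyD
  rw [Algebra.mem_iInf] at hy
  have h1 := hy ⟨center hDW, inferInstance⟩
  rw [Algebra.mem_iInf] at h1
  obtain ⟨a, s, hs, hys⟩ := h1 (hW.valuationRing_localization hDW)
  refine absurd ?_ hyW
  have hs1 : ¬ W.valuation s < 1 := fun h => hs (mem_center.2 h)
  rw [not_lt] at hs1
  rw [hys, map_mul, map_inv₀, φ.commutes, φ.commutes, ← W.valuation_le_one_iff, map_mul, map_inv₀]
  exact mul_le_one' ((W.valuation_le_one_iff _).2 (hDW a.2)) (inv_le_one_of_one_le₀ hs1)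

/-- A one-dimensional local domain which is not a valuation ring is not essential. -/
theorem not_isEssential_of_forall_isPrime {R : Type*} [CommRing R] [IsDomain R]
    (hprime : ∀ Q : Ideal R, Q.IsPrime → Q ≠ ⊥ → ∀ a, ¬ IsUnit a → a ∈ Q)
    (hval : ¬ ∀ a b : R, a ∣ b ∨ b ∣ a) (hne : ∃ a : R, a ≠ 0 ∧ ¬ IsUnit a) :
    ¬ IsEssential R := by
  rintro ⟨Δ, hΔ, hbot⟩
  -- the localization of `R` at a nonzero prime is `R`, and at the zero ideal it is a field
  by_cases hp : ∃ p ∈ Δ, p.asIdeal ≠ ⊥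
  · obtain ⟨p, hp, hp0⟩ := hp
    have hle : p.asIdeal.primeCompl ≤ IsUnit.submonoid R := fun a ha => by
      by_contra h
      exact ha (hprime _ p.isPrime hp0 a h)
    let e := IsLocalization.atUnits R p.asIdeal.primeCompl
      (S := Localization.AtPrime p.asIdeal) hle
    have := hΔ p hp
    refine hval fun a b => ?_
    have h1 := ValuationRing.dvd_total (e a) (e b)
    rwa [map_dvd_iff, map_dvd_iff] at h1
  · push Not at hp
    obtain ⟨a, ha0, ha⟩ := hne
    have h1 : (algebraMap R (FractionRing R) a)⁻¹ ∈ (⊥ : Subalgebra R (FractionRing R)) := by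
      rw [← hbot, Algebra.mem_iInf]
      intro p
      rw [Algebra.mem_iInf]
      intro hpΔ
      refine ⟨1, a, ?_, by simp⟩
      change a ∉ p.asIdeal
      rw [hp p hpΔ]
      simpa using ha0
    obtain ⟨b, hb⟩ := Algebra.mem_bot.1 h1
    refine ha (IsUnit.of_mul_eq_one b (IsFractionRing.injective R (FractionRing R) ?_))
    rw [map_mul, hb, map_one]
    exact mul_inv_cancel₀ (by simpa using ha0)

theorem ringKrullDim_eq_comap {E : Type*} [Field E] (e : E ≃+* L) (W : ValuationSubring E) :
    ringKrullDim W = ringKrullDim (W.comap e.symm.toRingHom) := by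
  let f : W.comap e.symm.toRingHom →+* W :=
    e.symm.toRingHom.restrict (W.comap e.symm.toRingHom) W fun _ h => h
  have hf : Function.Bijective f := by
    refine ⟨fun a b hab => Subtype.ext (e.symm.injective (congrArg (fun w : W => (w : E)) hab)),
      fun b => ⟨⟨e b, ?_⟩, Subtype.ext (e.symm_apply_apply _)⟩⟩
    change e.symm (e b) ∈ W
    rw [e.symm_apply_apply]
    exact b.2
  exact (ringKrullDim_eq_of_ringEquiv (RingEquiv.ofBijective f hf)).symm

/-- The valuative dimension of a domain can be computed in any quotient field. -/
theorem valuativeDim_eq [IsFractionRing D L] :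
    valuativeDim D = ⨆ W : {W : ValuationSubring L // D ≤ W.toSubring}, ringKrullDim W.1 := by
  let φ := (FractionRing.algEquiv D L).toRingEquiv
  have hφ : ∀ d : D, φ (algebraMap D (FractionRing D) d) = d :=
    (FractionRing.algEquiv D L).commutes
  apply le_antisymm
  · refine iSup₂_le fun W hW => ?_
    rw [ringKrullDim_eq_comap φ]
    refine le_iSup (fun W : {W : ValuationSubring L // D ≤ W.toSubring} => ringKrullDim W.1)
      ⟨W.comap φ.symm.toRingHom, fun d hd => ?_⟩
    have h := hW ⟨d, hd⟩
    rwa [← φ.symm_apply_apply (algebraMap D (FractionRing D) ⟨d, hd⟩), hφ] at h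
  · refine iSup_le fun W => ?_
    rw [ringKrullDim_eq_comap φ.symm]
    refine le_iSup₂ (f := fun (W : ValuationSubring (FractionRing D)) _ => ringKrullDim W)
      (W.1.comap φ.symm.symm.toRingHom) fun d => ?_
    change φ (algebraMap D (FractionRing D) d) ∈ W.1
    rw [hφ]
    exact W.2 d.2

/-- The height of a prime of `R[T]` is bounded by the dimension of `R_q[T]`, for any prime `q` which
contains the trace of the given prime on `R`. -/
theorem height_le_ringKrullDim_mvPolynomial {R B : Type*} [CommRing R] [CommRing B] [Algebra R B]
    {N : ℕ} (P : Ideal (MvPolynomial (Fin N) R)) [P.IsPrime] (q : Ideal R) [q.IsPrime]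
    [IsLocalization.AtPrime B q] (hPq : P.comap MvPolynomial.C ≤ q) :
    P.height ≤ ringKrullDim (MvPolynomial (Fin N) B) := by
  let := MvPolynomial.algebraMvPolynomial (σ := Fin N) (R := R) (S := B)
  let M : Submonoid (MvPolynomial (Fin N) R) := q.primeCompl.map (MvPolynomial.C (σ := Fin N))
  have : IsLocalization M (MvPolynomial (Fin N) B) := MvPolynomial.isLocalization _ _
  have hd : Disjoint (M : Set (MvPolynomial (Fin N) R)) P := by
    rw [Set.disjoint_left]
    rintro _ ⟨a, ha, rfl⟩ h
    exact ha (hPq h)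
  have := IsLocalization.isPrime_of_isPrime_disjoint M (MvPolynomial (Fin N) B) P inferInstance hd
  rw [← IsLocalization.height_map_of_disjoint (S := MvPolynomial (Fin N) B) M P hd]
  exact Ideal.height_le_ringKrullDim_of_isPrime

/-- If a ring `A` between a field `κ` and a field `L` of transcendence degree at most `d` over `κ`,
then `dim A[T₁, …, T_N] ≤ N + d`. -/
theorem ringKrullDim_mvPolynomial_le_of_trdeg_le {κ A L : Type*} [Field κ] [CommRing A] [IsDomain A]
    [Field L] [Algebra κ A] [Algebra A L] [Algebra κ L] [IsScalarTower κ A L]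
    (hA : Function.Injective (algebraMap A L)) {d : ℕ} (hd : Algebra.trdeg κ L ≤ d) (N : ℕ) :
    ringKrullDim (MvPolynomial (Fin N) A) ≤ N + d := by
  have h := ringKrullDim_le_of_algebraicIndependent (W := κ) (S := MvPolynomial (Fin N) A) (N + d)
    fun m y hy => by
      have h1 := (hy.map' (f := MvPolynomial.mapAlgHom (IsScalarTower.toAlgHom κ A L))
        (MvPolynomial.map_injective _ hA)).lift_cardinalMk_le_trdeg
      rw [← trdeg_add_eq κ L, MvPolynomial.trdeg_of_isDomain] at h1
      have h2 : (m : Cardinal) ≤ d + N := by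
        refine le_trans (by simpa using h1) (add_le_add_left hd _)
      have h3 : m ≤ d + N := by exact_mod_cast h2
      lia
  rw [ringKrullDim_eq_zero_of_field, add_zero] at h
  exact_mod_cast h

/-- Polynomial rings over a valuation ring have the expected dimension. -/
theorem ringKrullDim_mvPolynomial_le_of_valuationRing {V : Type*} [CommRing V] [IsDomain V]
    [ValuationRing V] (N : ℕ) : ringKrullDim (MvPolynomial (Fin N) V) ≤ N + ringKrullDim V := by
  refine ringKrullDim_le_of_algebraicIndependent N fun m y hy => ?_
  have h := hy.lift_cardinalMk_le_trdeg
  rw [MvPolynomial.trdeg_of_isDomain] at h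
  simpa using h

end Localization

/-! ### Valuation rings containing the union of the `Dₙ` -/

section Union

variable {k₀ L : Type*} [Field k₀] [Field L] [Algebra k₀ L] {r : ℕ} {x : Indet r → L}

/-- The union `D` of the rings `Dₙ`. -/
def DUnion (k₀ : Type*) {L : Type*} [Field k₀] [Field L] [Algebra k₀ L] {r : ℕ}
    (x : Indet r → L) : Subring L :=
  ⨆ n, DAt k₀ x n

/-- The union `A` of the rings `Aₙ`. -/
def AUnion (k₀ : Type*) {L : Type*} [Field k₀] [Field L] [Algebra k₀ L] {r : ℕ}
    (x : Indet r → L) : Subring L :=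
  ⨆ n, AAt k₀ x n

/-- The union `k` of the fields `kₙ`. -/
def kUnion (k₀ : Type*) {L : Type*} [Field k₀] [Field L] [Algebra k₀ L] {r : ℕ}
    (x : Indet r → L) : IntermediateField k₀ L :=
  gen k₀ x (Set.range Indet.X)

theorem mem_DUnion {a : L} : a ∈ DUnion k₀ x ↔ ∃ n, a ∈ DAt k₀ x n :=
  Subring.mem_iSup_of_directed DAt_mono.directed_le

theorem mem_AUnion {a : L} : a ∈ AUnion k₀ x ↔ ∃ n, a ∈ AAt k₀ x n :=
  Subring.mem_iSup_of_directed AAt_mono.directed_le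

theorem DAt_le_DUnion (n : ℕ) : DAt k₀ x n ≤ DUnion k₀ x := fun _ h => mem_DUnion.2 ⟨n, h⟩

theorem AAt_le_AUnion (n : ℕ) : AAt k₀ x n ≤ AUnion k₀ x := fun _ h => mem_AUnion.2 ⟨n, h⟩

theorem DUnion_le_AUnion : DUnion k₀ x ≤ AUnion k₀ x := by
  intro a ha
  obtain ⟨n, hn⟩ := mem_DUnion.1 ha
  exact AAt_le_AUnion n (DAt_le_AAt n hn)

theorem mem_gen_iUnion {ι : Type*} {x : ι → L} {S : ℕ → Set ι} (hS : Monotone S) {a : L}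
    (ha : a ∈ gen k₀ x (⋃ n, S n)) : ∃ n, a ∈ gen k₀ x (S n) := by
  have hdir : Directed (· ≤ ·) fun n => gen k₀ x (S n) :=
    Monotone.directed_le fun _ _ h => gen_mono (hS h)
  have h1 : gen k₀ x (⋃ n, S n) ≤ ⨆ n, gen k₀ x (S n) := by
    rw [IntermediateField.adjoin_le_iff]
    rintro _ ⟨i, hi, rfl⟩
    obtain ⟨n, hn⟩ := Set.mem_iUnion.1 hi
    exact le_iSup (fun n => gen k₀ x (S n)) n (mem_gen hn)
  have h2 := h1 ha
  rw [← SetLike.mem_coe, IntermediateField.coe_iSup_of_directed hdir] at h2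
  exact Set.mem_iUnion.1 h2

theorem exists_mem_kAt {a : L} (ha : a ∈ kUnion k₀ x) : ∃ n, a ∈ kAt k₀ x n := by
  have h : Set.range (Indet.X (r := r)) = ⋃ n, kSet r n := by
    ext i
    simp only [Set.mem_range, kSet, Set.mem_iUnion, Set.mem_image, Set.mem_Iic]
    exact ⟨fun ⟨n, hn⟩ => ⟨n, n, le_rfl, hn⟩, fun ⟨_, n, _, hn⟩ => ⟨n, hn⟩⟩
  rw [kUnion, h] at ha
  obtain ⟨n, hn⟩ := mem_gen_iUnion (fun _ _ => kSet_mono) ha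
  exact ⟨n, kAt_eq (k₀ := k₀) (x := x) n ▸ hn⟩

theorem kUnion_le_AUnion {a : L} (ha : a ∈ kUnion k₀ x) : a ∈ AUnion k₀ x := by
  obtain ⟨n, hn⟩ := exists_mem_kAt ha
  exact AAt_le_AUnion n (mem_AAt_of_mem_kAt hn)

theorem exists_mem_KAt (htop : gen k₀ x Set.univ = ⊤) (a : L) : ∃ n, a ∈ KAt k₀ x n := by
  have h : (Set.univ : Set (Indet r)) = ⋃ n, KSet r n := by
    refine (Set.eq_univ_of_forall fun i => Set.mem_iUnion.2 ?_).symm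
    cases i with
    | X n => exact ⟨n, Or.inr (Or.inl ⟨n, Set.mem_Iic.2 le_rfl, rfl⟩)⟩
    | Z i => exact ⟨0, Or.inr (Or.inr ⟨i, rfl⟩)⟩
    | Y => exact ⟨0, Or.inl rfl⟩
  have ha : a ∈ gen k₀ x Set.univ := htop ▸ IntermediateField.mem_top
  rw [h] at ha
  exact mem_gen_iUnion (fun _ _ => KSet_mono) ha

/-- The finite set of the indeterminates `Y` and `Z`. -/
def YZFinset (r : ℕ) : Finset (Indet r) :=
  Finset.cons .Y (ZFinset r) (by simp [ZFinset])

theorem coe_YZFinset : (YZFinset r : Set (Indet r)) = insert .Y (Set.range Indet.Z) := by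
  rw [YZFinset, Finset.coe_cons, ZFinset, Finset.coe_map, Finset.coe_univ, Set.image_univ]
  rfl

theorem card_YZFinset_le (hr : 1 ≤ r) : (YZFinset r).card ≤ r := by
  rw [YZFinset, Finset.card_cons, card_ZFinset]
  lia

theorem mem_adjoin_kAt {n : ℕ} {a : L} (ha : a ∈ KAt k₀ x n) :
    a ∈ IntermediateField.adjoin (kAt k₀ x n) (x '' YZFinset r) := by
  have h : KSet r n = kSet r n ∪ (YZFinset r : Set (Indet r)) := by
    rw [coe_YZFinset, KSet, FSet, Set.union_insert]
  rw [KAt, h, mem_gen_union] at ha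
  rwa [kAt_eq]

theorem mem_adjoin_kUnion (htop : gen k₀ x Set.univ = ⊤) (a : L) :
    a ∈ IntermediateField.adjoin (kUnion k₀ x) (x '' YZFinset r) := by
  have h : (Set.univ : Set (Indet r)) = Set.range Indet.X ∪ (YZFinset r : Set (Indet r)) := by
    rw [coe_YZFinset]
    refine (Set.eq_univ_of_forall fun i => ?_).symm
    cases i with
    | X n => exact Or.inl ⟨n, rfl⟩
    | Z i => exact Or.inr (Or.inr ⟨i, rfl⟩)
    | Y => exact Or.inr (Or.inl rfl)
  have ha : a ∈ gen k₀ x Set.univ := htop ▸ IntermediateField.mem_top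
  rwa [h, mem_gen_union] at ha

/-- If `W` contains a field `κ`, and its values are values of elements of a field generated by a
finite set `T` over `κ`, then the dimension of `W` is at most `#T`. -/
theorem ringKrullDim_le_card {ι : Type*} {x : ι → L} {W : ValuationSubring L}
    (κ : IntermediateField k₀ L) (T : Finset ι) (hκ : ∀ a ∈ κ, a ∈ W)
    (h : ∀ a : L, ∃ b ∈ IntermediateField.adjoin κ (x '' T), W.valuation a = W.valuation b) :
    ringKrullDim W ≤ T.card := by
  -- the primes of `W` are determined by their traces on `S`
  let S : Subring L := W.toSubring ⊓ (IntermediateField.adjoin κ (x '' T)).toSubring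
  let f : S →+* W := S.subtype.codRestrict W fun a => a.2.1
  have h1 : ringKrullDim W ≤ ringKrullDim S := by
    refine Order.krullDim_le_of_strictMono (PrimeSpectrum.comap f) fun P Q hPQ => ?_
    refine lt_of_le_not_ge (Ideal.comap_mono hPQ.le) fun hle => ?_
    obtain ⟨z, hz, hz'⟩ := SetLike.exists_of_lt (show P.asIdeal < Q.asIdeal from hPQ)
    obtain ⟨b, hb, hzb⟩ := h z
    obtain ⟨u, hu⟩ := (W.valuation_eq_iff _ _).1 hzb
    have hbW : b ∈ W := by
      rw [← W.valuation_le_one_iff, ← hzb]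
      exact W.valuation_le_one z
    have huz : (u : W) * f ⟨b, hbW, hb⟩ = z := Subtype.ext hu
    have hbQ : f ⟨b, hbW, hb⟩ ∈ Q.asIdeal := by
      rwa [← huz, Ideal.unit_mul_mem_iff_mem _ u.isUnit] at hz
    have hbP : f ⟨b, hbW, hb⟩ ∈ P.asIdeal := hle hbQ
    exact hz' (huz ▸ Ideal.mul_mem_left _ _ hbP)
  have hκS : ∀ a : κ, algebraMap κ L a ∈ S := fun a =>
    ⟨hκ a a.2, IntermediateField.algebraMap_mem _ a⟩
  let := ((algebraMap κ L).codRestrict S hκS).toAlgebra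
  have : IsScalarTower κ S L := .of_algebraMap_eq fun _ => rfl
  have : FaithfulSMul κ S :=
    (faithfulSMul_iff_algebraMap_injective κ S).2 (RingHom.injective _)
  have h2 := ringKrullDim_le_of_algebraicIndependent (W := κ) (S := S) T.card fun m y hy => by
    refine le_card_of_algebraicIndependent T (fun i => (y i : L))
      (hy.map' (f := IsScalarTower.toAlgHom κ S L) Subtype.val_injective) fun i => (y i).2.2
  rw [ringKrullDim_eq_zero_of_field, add_zero] at h2
  exact h1.trans h2

variable (hx : AlgebraicIndependent k₀ x)

include hx

theorem inv_tAt_mem_DUnion (n : ℕ) : (tAt x (n + 1))⁻¹ ∈ DUnion k₀ x :=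
  DAt_le_DUnion _ (inv_tAt_mem_DAt hx n)

/-- The values of `W` on `Kₙ₊₁` and on `Kₙ` agree if `W` contains `Xₙ₊₁'`. -/
theorem exists_valuation_eq {W : ValuationSubring L} {n : ℕ} (hW : DAt k₀ x (n + 1) ≤ W.toSubring)
    (ht : tAt x (n + 1) ∈ W) {a : L} (ha : a ∈ KAt k₀ x (n + 1)) :
    ∃ b ∈ KAt k₀ x n, W.valuation a = W.valuation b := by
  have hG := isGauss_of_kronecker_le (kronecker_le_of_tAt_mem hx hW ht) (transcendental_tAt hx n)
  obtain ⟨f, g, hg, rfl⟩ := (exists_fraction hx n).2 a ha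
  obtain ⟨i, hi⟩ := hG.exists_eq f
  obtain ⟨j, hj⟩ := hG.exists_eq g
  refine ⟨f.coeff i / g.coeff j,
    div_mem (DAt_le_KAt n (f.coeff i).2) (DAt_le_KAt n (g.coeff j).2), ?_⟩
  rw [map_div₀, map_div₀, hi, hj]
  rfl

variable (htop : gen k₀ x Set.univ = ⊤)

include htop

/-- The valuation rings containing `D` have dimension at most `r`. -/
theorem ringKrullDim_le_of_DUnion_le (hr : 1 ≤ r) {W : ValuationSubring L}
    (hW : DUnion k₀ x ≤ W.toSubring) : ringKrullDim W ≤ r := by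
  classical
  have hD : ∀ n, DAt k₀ x n ≤ W.toSubring := fun n => (DAt_le_DUnion n).trans hW
  have hcard : ((YZFinset r).card : WithBot ℕ∞) ≤ r := by
    exact_mod_cast card_YZFinset_le hr
  refine le_trans ?_ hcard
  -- if `W` contains `A`, it contains the field `k`
  by_cases h : ∀ n, AAt k₀ x n ≤ W.toSubring
  · refine ringKrullDim_le_card (x := x) (kUnion k₀ x) _ (fun a ha => ?_)
      fun a => ⟨a, mem_adjoin_kUnion htop a, rfl⟩
    obtain ⟨n, hn⟩ := exists_mem_kAt ha
    exact h n (mem_AAt_of_mem_kAt hn)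
  · push Not at h
    -- `N` is the last index with `A_N ⊆ W`; beyond it `W` is an iterated Gauss extension
    obtain ⟨N, hN, hN'⟩ : ∃ N, AAt k₀ x N ≤ W.toSubring ∧ ¬ AAt k₀ x (N + 1) ≤ W.toSubring := by
      have hpos : Nat.find h ≠ 0 := fun h0 => Nat.find_spec h (h0 ▸ hD 0)
      obtain ⟨N, hN⟩ := Nat.exists_eq_succ_of_ne_zero hpos
      refine ⟨N, not_not.1 (Nat.find_min h (by lia)), ?_⟩
      rw [← Nat.succ_eq_add_one, ← hN]
      exact Nat.find_spec h
    have ht : ∀ n ≥ N, tAt x (n + 1) ∈ W := fun n hn =>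
      (tAt_mem_or_AAt_le hx (hD _)).resolve_right fun h => hN' ((AAt_mono (by lia)).trans h)
    have hv : ∀ n, ∀ a ∈ KAt k₀ x (N + n), ∃ b ∈ KAt k₀ x N, W.valuation a = W.valuation b := by
      intro n
      induction n with
      | zero => exact fun a ha => ⟨a, ha, rfl⟩
      | succ n ih =>
        intro a ha
        obtain ⟨b, hb, hab⟩ := exists_valuation_eq hx (hD _) (ht (N + n) (by lia)) ha
        obtain ⟨c, hc, hbc⟩ := ih b hb
        exact ⟨c, hc, hab.trans hbc⟩
    refine ringKrullDim_le_card (x := x) (kAt k₀ x N) _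
      (fun a ha => hN (mem_AAt_of_mem_kAt ha)) fun a => ?_
    obtain ⟨n, hn⟩ := exists_mem_KAt htop a
    obtain ⟨b, hb, hab⟩ := hv n a (gen_mono (KSet_mono (by lia)) hn)
    exact ⟨b, mem_adjoin_kAt hb, hab⟩

/-- A valuation ring containing `D` and almost all `Xₙ'` contains almost all of the Kronecker
function rings, hence is a localization of `D`. -/
theorem isFractional_of_tAt_mem {W : ValuationSubring L} (hW : DUnion k₀ x ≤ W.toSubring) {N : ℕ}
    (ht : ∀ n ≥ N, tAt x (n + 1) ∈ W) : IsFractional (DUnion k₀ x) W := by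
  intro a ha
  obtain ⟨m, hm⟩ := exists_mem_KAt htop a
  set n := max m N
  have hD : DAt k₀ x (n + 1) ≤ W.toSubring := (DAt_le_DUnion _).trans hW
  have htn := ht n (le_max_right _ _)
  obtain ⟨f, g, hg, hfg⟩ := (exists_fraction hx n).2 a (gen_mono (KSet_mono (by lia)) hm)
  obtain ⟨h0, h1, h2⟩ := exists_denominator (transcendental_tAt hx n) hg hfg (Nat.lt_succ_self _)
  set t := tAt x (n + 1)
  have ht0 : t ≠ 0 := tAt_ne_zero hx (n + 1)
  have htW : t⁻¹ ∈ W := hW (inv_tAt_mem_DUnion hx n)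
  have hvt : W.valuation t⁻¹ = 1 := by
    refine le_antisymm ((W.valuation_le_one_iff _).2 htW) ?_
    rw [map_inv₀]
    exact (one_le_inv₀ (zero_lt_iff.2 (by simpa using ht0))).2 ((W.valuation_le_one_iff _).2 htn)
  set u := 1 + a * t⁻¹ ^ (f.natDegree + 1) with hu
  have huW : u ∈ W := W.add_mem _ _ W.one_mem (W.mul_mem _ _ ha (pow_mem htW _))
  have hvu : W.valuation u⁻¹ = 1 := by
    refine le_antisymm ((W.valuation_le_one_iff _).2 (kronecker_le_of_tAt_mem hx hD htn h1)) ?_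
    rw [map_inv₀]
    exact (one_le_inv₀ (zero_lt_iff.2 (by simpa using h0))).2 ((W.valuation_le_one_iff _).2 huW)
  obtain ⟨M₁, hM₁⟩ := exists_mul_inv_pow_mem_DAt hx h1
  obtain ⟨M₂, hM₂⟩ := exists_mul_inv_pow_mem_DAt hx h2
  refine ⟨_, DAt_le_DUnion _ (hM₂ (max M₁ M₂) (le_max_right _ _)), _,
    DAt_le_DUnion _ (hM₁ (max M₁ M₂) (le_max_left _ _)), ?_, ?_⟩
  · rw [map_mul, map_pow]
    change W.valuation u⁻¹ * W.valuation t⁻¹ ^ _ = 1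
    rw [hvu, hvt, one_pow, one_mul]
  · change a = u⁻¹ * a * t⁻¹ ^ max M₁ M₂ / (u⁻¹ * t⁻¹ ^ max M₁ M₂)
    rw [mul_right_comm, mul_div_cancel_left₀]
    exact mul_ne_zero (inv_ne_zero h0) (pow_ne_zero _ (inv_ne_zero ht0))

/-- A prime of `D` which contains an element outside of all `Y Vₙ` contains only finitely many of
the elements `1 / Xₙ'`, so its localization is a valuation ring. -/
theorem exists_center_eq_of_mem {p : Ideal (DUnion k₀ x)} [p.IsPrime] {d : DUnion k₀ x}
    (hd : d ∈ p) (hd' : ∀ n, ∀ v ∈ VAt k₀ x n, (d : L) ≠ x .Y * v) :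
    ∃ (W : ValuationSubring L) (h : DUnion k₀ x ≤ W.toSubring),
      IsFractional (DUnion k₀ x) W ∧ center h = p := by
  obtain ⟨W, hW⟩ := exists_valuationSubring_center (DUnion k₀ x).subtype Subtype.val_injective p
  have hle : DUnion k₀ x ≤ W.toSubring := fun a ha => (hW ⟨a, ha⟩).1
  obtain ⟨N, hN⟩ := mem_DUnion.1 d.2
  refine ⟨W, hle, isFractional_of_tAt_mem hx htop hle (N := N) fun n hn => ?_, ?_⟩
  -- `1 / d` is in `Aₙ₊₁`; its denominator `s` over `Dₙ₊₁` is in `p`, like `d`, and `1 - s` is not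
  · have hdA : (d : L) ∈ AAt k₀ x (n + 1) := DAt_le_AAt _ (DAt_mono (by lia) hN)
    obtain ⟨s, hs, hsd, h⟩ := exists_mul_mem_DAt hx (inv_mem_AAt_of_notMem hx hdA (hd' _))
    have hd0 : (d : L) ≠ 0 := fun h0 => hd' 0 0 (zero_mem _) (by rw [h0, mul_zero])
    have hdp : W.valuation d < 1 := (hW d).2.2 hd
    have hs1 : W.valuation s < 1 := by
      have h1 : s = s * (d : L)⁻¹ * d := by field_simp
      rw [h1, map_mul]
      exact (mul_le_of_le_one_left' ((W.valuation_le_one_iff _).2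
        (hle (DAt_le_DUnion _ hsd)))).trans_lt hdp
    have h2 : W.valuation (1 - s) = 1 := by
      rw [W.valuation.map_sub_eq_of_lt_left (by rwa [map_one]), map_one]
    have h3 := (W.valuation_le_one_iff _).2 (hle (DAt_le_DUnion _ h))
    rw [map_mul, h2, one_mul] at h3
    exact (W.valuation_le_one_iff _).1 h3
  · ext a
    rw [mem_center]
    exact (hW a).2

end Union

/-! ### The localization of `D` which is not essential -/

section Center

variable {k₀ L : Type*} [Field k₀] [Field L] [Algebra k₀ L] {r : ℕ} {x : Indet r → L}

theorem DUnion_mul_mem_VAt {n : ℕ} {d v : L} (hd : d ∈ DUnion k₀ x) (hv : v ∈ VAt k₀ x n) :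
    ∃ m ≥ n, d * v ∈ VAt k₀ x m := by
  obtain ⟨m, hm⟩ := mem_DUnion.1 hd
  exact ⟨max m n, le_max_right _ _, mul_mem (VAt_mono (le_max_left _ _) (AAt_le_VAt _
    (DAt_le_AAt _ hm))) (VAt_mono (le_max_right _ _) hv)⟩

/-- The ideal of the elements of `D` which lie in `Y Vₙ` for some `n`. -/
def idealY (k₀ : Type*) {L : Type*} [Field k₀] [Field L] [Algebra k₀ L] {r : ℕ}
    (x : Indet r → L) : Ideal (DUnion k₀ x) where
  carrier := {d | ∃ n, ∃ v ∈ VAt k₀ x n, (d : L) = x .Y * v}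
  zero_mem' := ⟨0, 0, zero_mem _, by simp⟩
  add_mem' := by
    rintro a b ⟨n, v, hv, ha⟩ ⟨m, w, hw, hb⟩
    refine ⟨max n m, v + w, add_mem (VAt_mono (le_max_left _ _) hv)
      (VAt_mono (le_max_right _ _) hw), ?_⟩
    rw [Subring.coe_add, ha, hb, mul_add]
  smul_mem' := by
    rintro c a ⟨n, v, hv, ha⟩
    obtain ⟨m, -, h⟩ := DUnion_mul_mem_VAt c.2 hv
    refine ⟨m, _, h, ?_⟩
    rw [smul_eq_mul, Subring.coe_mul, ha, mul_left_comm]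

variable (hx : AlgebraicIndependent k₀ x)

include hx

theorem inv_mem_AUnion_of_notMem {a : L} (ha : a ∈ AUnion k₀ x)
    (h : ∀ n, ∀ v ∈ VAt k₀ x n, a ≠ x .Y * v) : a⁻¹ ∈ AUnion k₀ x := by
  obtain ⟨n, hn⟩ := mem_AUnion.1 ha
  exact AAt_le_AUnion n (inv_mem_AAt_of_notMem hx hn (h n))

theorem isPrime_idealY : (idealY k₀ x).IsPrime := by
  refine ⟨fun h => ?_, fun {a b} hab => or_iff_not_imp_left.2 fun ha => ?_⟩
  · obtain ⟨n, v, hv, h1⟩ := (Ideal.eq_top_iff_one _).1 h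
    exact one_add_Y_mul_ne_zero hx (neg_mem hv) (by rw [mul_neg, ← h1, OneMemClass.coe_one]; ring)
  · have ha' : ∀ n, ∀ v ∈ VAt k₀ x n, (a : L) ≠ x .Y * v := fun n v hv h => ha ⟨n, v, hv, h⟩
    have ha0 : (a : L) ≠ 0 := fun h0 => ha' 0 0 (zero_mem _) (by rw [h0, mul_zero])
    obtain ⟨n, hn⟩ := mem_AUnion.1 (inv_mem_AUnion_of_notMem hx (DUnion_le_AUnion a.2) ha')
    obtain ⟨m, v, hv, h⟩ := hab
    refine ⟨max n m, (a : L)⁻¹ * v, mul_mem (VAt_mono (le_max_left _ _) (AAt_le_VAt _ hn))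
      (VAt_mono (le_max_right _ _) hv), ?_⟩
    rw [mul_left_comm, ← h, Subring.coe_mul, inv_mul_cancel_left₀ ha0]

/-- The localization of `D` at the ideal of the elements in some `Y Vₙ` is the union of the
rings `Aₙ`. -/
theorem isLocalization_AUnion :
    letI := (Subring.inclusion (DUnion_le_AUnion (k₀ := k₀) (x := x))).toAlgebra
    have := isPrime_idealY hx
    IsLocalization.AtPrime (AUnion k₀ x) (idealY k₀ x) := by
  let := (Subring.inclusion (DUnion_le_AUnion (k₀ := k₀) (x := x))).toAlgebra
  have := isPrime_idealY hx
  refine isLocalization_atPrime_of_subring_le _ _ (fun d hd => ?_) fun b hb => ?_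
  · exact inv_mem_AUnion_of_notMem hx (DUnion_le_AUnion d.2) fun n v hv h => hd ⟨n, v, hv, h⟩
  · obtain ⟨n, hn⟩ := mem_AUnion.1 hb
    obtain ⟨s, hs, hsb, h⟩ := exists_mul_mem_DAt hx (AAt_mono n.le_succ hn)
    -- `1 - s` is a multiple of `1 / Xₙ₊₁'`, which is in the ideal
    obtain ⟨v, hv, hv'⟩ := inv_tAt hx (n + 1)
    obtain ⟨m, -, hm⟩ := DUnion_mul_mem_VAt (DAt_le_DUnion _ h) hv
    refine ⟨s, DAt_le_DUnion _ hs, DAt_le_DUnion _ hsb,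
      sub_mem (one_mem _) (DAt_le_DUnion _ hs), m, _, hm, ?_⟩
    rw [mul_left_comm, ← hv', mul_assoc, mul_inv_cancel₀ (tAt_ne_zero hx _), mul_one]

theorem exists_eq_Y_mul_of_not_isUnit {a : AUnion k₀ x} (ha : ¬ IsUnit a) :
    ∃ n, ∃ v ∈ VAt k₀ x n, (a : L) = x .Y * v := by
  by_contra! h
  have ha0 : (a : L) ≠ 0 := fun h0 => h 0 0 (zero_mem _) (by rw [h0, mul_zero])
  exact ha (IsUnit.of_mul_eq_one (⟨_, inv_mem_AUnion_of_notMem hx a.2 h⟩ : AUnion k₀ x)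
    (Subtype.ext (mul_inv_cancel₀ ha0)))

/-- The union of the rings `Aₙ` is local and one-dimensional. -/
theorem mem_of_not_isUnit_of_ne_bot (htop : gen k₀ x Set.univ = ⊤) {Q : Ideal (AUnion k₀ x)}
    (hQ : Q.IsPrime) (hQ0 : Q ≠ ⊥) {a : AUnion k₀ x} (ha : ¬ IsUnit a) : a ∈ Q := by
  obtain ⟨q, hq, hq0⟩ := Submodule.exists_mem_ne_zero_of_ne_bot hQ0
  have hq0' : (q : L) ≠ 0 := fun h => hq0 (Subtype.ext h)
  obtain ⟨n, v, hv, hav⟩ := exists_eq_Y_mul_of_not_isUnit hx ha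
  obtain ⟨m, hm⟩ := exists_mem_KAt htop (q : L)⁻¹
  obtain ⟨N, hN⟩ := exists_pow_mul_mem_VAt hm
  have hw : x .Y ^ N * (q : L)⁻¹ * v ^ (N + 1) ∈ VAt k₀ x (max m n) :=
    mul_mem (VAt_mono (le_max_left _ _) hN) (pow_mem (VAt_mono (le_max_right _ _) hv) _)
  refine hQ.mem_of_pow_mem (N + 1) ?_
  have h1 : a ^ (N + 1) = ⟨_, AAt_le_AUnion _ (Y_mul_mem_AAt hw)⟩ * q := by
    refine Subtype.ext ?_
    rw [Subring.coe_mul, Subring.coe_pow, hav]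
    field_simp
    ring
  rw [h1]
  exact Q.mul_mem_left _ hq

theorem mem_kAt_of_mem_AAt {n : ℕ} {a : L} (ha : a ∈ AAt k₀ x n) (ha' : a ∈ FAt k₀ x n) :
    a ∈ kAt k₀ x n := by
  obtain ⟨c, hc, v, hv, rfl⟩ := ha
  have h1 : x .Y * v ∈ FAt k₀ x n := by
    have := sub_mem ha' (kAt_le_FAt n hc)
    rwa [add_sub_cancel_left] at this
  have h2 := eq_zero_of_add_Y_mul_eq_zero hx (neg_mem h1) hv (neg_add_cancel _)
  rw [neg_eq_zero] at h2
  rwa [h2, add_zero]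

/-- Neither `Z₀` nor its inverse lies in the union of the rings `Aₙ`, which is therefore not a
valuation ring. -/
theorem not_forall_dvd (hr : 2 ≤ r) : ¬ ∀ a b : AUnion k₀ x, a ∣ b ∨ b ∣ a := by
  intro h
  let i : Fin (r - 1) := ⟨0, by lia⟩
  have hZF : ∀ n, x (.Z i) ∈ FAt k₀ x n := fun n => by
    rw [FAt_eq]
    exact mem_gen (Or.inr ⟨i, rfl⟩)
  have hZk : ∀ n, x (.Z i) ∉ kAt k₀ x n := fun n => by
    rw [kAt_eq]
    refine notMem_gen hx ?_
    rintro ⟨j, -, hj⟩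
    cases hj
  have hZ0 : x (.Z i) ≠ 0 := fun h0 => hZk 0 (h0 ▸ zero_mem _)
  have hY := Y_ne_zero hx
  have hYA : x .Y * 1 ∈ AUnion k₀ x := AAt_le_AUnion 0 (Y_mul_mem_AAt (one_mem _))
  have hYZ : x .Y * x (.Z i) ∈ AUnion k₀ x :=
    AAt_le_AUnion 0 (Y_mul_mem_AAt (mem_VAt_of_mem_FAt (hZF 0)))
  rcases h ⟨_, hYA⟩ ⟨_, hYZ⟩ with ⟨c, hc⟩ | ⟨c, hc⟩
  · have h1 : x .Y * x (.Z i) = x .Y * 1 * c := congrArg Subtype.val hc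
    have h2 : x (.Z i) = c := by
      rw [mul_one] at h1
      exact mul_left_cancel₀ hY h1
    obtain ⟨n, hn⟩ := mem_AUnion.1 c.2
    exact hZk n (mem_kAt_of_mem_AAt hx (h2 ▸ hn) (hZF n))
  · have h1 : x .Y * 1 = x .Y * x (.Z i) * c := congrArg Subtype.val hc
    have h2 : (x (.Z i))⁻¹ = c := by
      rw [mul_assoc] at h1
      exact inv_eq_of_mul_eq_one_right (mul_left_cancel₀ hY h1).symm
    obtain ⟨n, hn⟩ := mem_AUnion.1 c.2
    have h3 := mem_kAt_of_mem_AAt hx (h2 ▸ hn) (inv_mem (hZF n))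
    exact hZk n (inv_inv (x (.Z i)) ▸ inv_mem h3)

theorem not_isLocallyEssential (htop : gen k₀ x Set.univ = ⊤) (hr : 2 ≤ r) :
    ¬ IsLocallyEssential (DUnion k₀ x) := by
  intro h
  let := (Subring.inclusion (DUnion_le_AUnion (k₀ := k₀) (x := x))).toAlgebra
  have := isPrime_idealY hx
  have hloc := isLocalization_AUnion hx
  let e := (IsLocalization.algEquiv (idealY k₀ x).primeCompl (AUnion k₀ x)
    (Localization.AtPrime (idealY k₀ x))).toRingEquiv
  refine not_isEssential_of_forall_isPrime (fun Q hQ hQ0 a ha => ?_) (fun hval => ?_) ?_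
    (h ⟨idealY k₀ x, this⟩)
  · have h1 := mem_of_not_isUnit_of_ne_bot hx htop (Q := Q.comap e) inferInstance (fun h0 => hQ0 ?_)
      (a := e.symm a) (by simpa using ha)
    · rwa [Ideal.mem_comap, e.apply_symm_apply] at h1
    · rw [← Ideal.map_comap_of_surjective e e.surjective Q, h0, Ideal.map_bot]
  · refine not_forall_dvd hx hr fun a b => ?_
    have h1 := hval (e a) (e b)
    rwa [map_dvd_iff, map_dvd_iff] at h1
  · refine ⟨e ⟨x .Y * 1, AAt_le_AUnion 0 (Y_mul_mem_AAt (one_mem _))⟩, ?_, ?_⟩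
    · rw [Ne, EmbeddingLike.map_eq_zero_iff]
      intro h0
      exact Y_ne_zero hx (by simpa using congrArg Subtype.val h0)
    · rw [isUnit_map_iff]
      intro hu
      obtain ⟨c, hc⟩ := hu.exists_right_inv
      obtain ⟨n, hn⟩ := mem_AUnion.1 c.2
      have h1 : x .Y * 1 * (c : L) = 1 := congrArg Subtype.val hc
      refine one_add_Y_mul_ne_zero hx (neg_mem (AAt_le_VAt n hn)) ?_
      rw [← h1]
      ring

end Center

/-! ### Iterated Gauss extensions -/

section Tower

variable {k₀ L : Type*} [Field k₀] [Field L] [Algebra k₀ L] {r : ℕ} {x : Indet r → L}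

theorem IsGauss.of_le {K : IntermediateField k₀ L} {R : Subring L} (h : ∀ a ∈ R, a ∈ K)
    {W : ValuationSubring L} {t : L} (hG : IsGauss K W t) : IsGauss R W t := by
  let ι : R →+* K := Subring.inclusion (T := K.toSubring) h
  have h1 : (algebraMap K L).comp ι = algebraMap R L := RingHom.ext fun _ => rfl
  refine ⟨hG.1, fun f i => ?_⟩
  have h2 := hG.2 (f.map ι) i
  rwa [aeval_def, eval₂_map, h1, ← aeval_def, coeff_map, ← RingHom.comp_apply, h1] at h2

variable (hx : AlgebraicIndependent k₀ x)

include hx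

theorem exists_gauss_step (n : ℕ) (W₀ : ValuationSubring L) :
    ∃ W : ValuationSubring L, (∀ a ∈ KAt k₀ x n, a ∈ W ↔ a ∈ W₀) ∧ tAt x (n + 1) ∈ W ∧
      (DAt k₀ x n ≤ W₀.toSubring → DAt k₀ x (n + 1) ≤ W.toSubring) := by
  obtain ⟨W, hW, hG⟩ := exists_isGauss (W₀.comap (algebraMap (KAt k₀ x n) L))
    (transcendental_tAt_KAt hx n)
  have hW' : ∀ a ∈ KAt k₀ x n, a ∈ W ↔ a ∈ W₀ := fun a ha => hW ⟨a, ha⟩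
  refine ⟨W, hW', hG.1, fun h => inf_le_left.trans ?_⟩
  exact kronecker_le_of_isGauss (R := DAt k₀ x n) (fun a => (hW' a (DAt_le_KAt n a.2)).2 (h a.2))
    (hG.of_le fun _ => DAt_le_KAt n)

/-- A valuation ring containing `Dₙ` may be changed outside of `Kₙ` so as to contain `D`, by taking
Gauss extensions for all the further indeterminates. -/
theorem exists_gauss_tower (htop : gen k₀ x Set.univ = ⊤) {n : ℕ} {W₀ : ValuationSubring L}
    (h : DAt k₀ x n ≤ W₀.toSubring) :
    ∃ W : ValuationSubring L, DUnion k₀ x ≤ W.toSubring ∧ (∀ a ∈ KAt k₀ x n, a ∈ W ↔ a ∈ W₀) ∧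
      ∀ m ≥ n, tAt x (m + 1) ∈ W := by
  choose g hg hgt hgD using exists_gauss_step (k₀ := k₀) hx
  let w : ℕ → ValuationSubring L := fun j => Nat.rec W₀ (fun j W => g (n + j) W) j
  have hw : ∀ j, w (j + 1) = g (n + j) (w j) := fun _ => rfl
  have hwD : ∀ j, DAt k₀ x (n + j) ≤ (w j).toSubring := by
    intro j
    induction j with
    | zero => exact h
    | succ j ih => exact hgD _ _ ih
  have hstab : ∀ j i, ∀ a ∈ KAt k₀ x (n + j), a ∈ w (j + i) ↔ a ∈ w j := by
    intro j i
    induction i with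
    | zero => exact fun a ha => Iff.rfl
    | succ i ih =>
      intro a ha
      rw [← ih a ha, ← add_assoc, hw]
      exact hg _ _ a (gen_mono (KSet_mono (by lia)) ha)
  have hstab' : ∀ j, ∀ a ∈ KAt k₀ x (n + j), a ∈ w j → ∀ i ≥ j, a ∈ w i := by
    intro j a ha haj i hi
    obtain ⟨i, rfl⟩ := Nat.exists_eq_add_of_le hi
    exact (hstab j i a ha).2 haj
  -- the limit of the sequence, which is constant on each `Kₙ` from some index on
  let W : ValuationSubring L :=
    { carrier := {a | ∃ j, ∀ i ≥ j, a ∈ w i}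
      zero_mem' := ⟨0, fun i _ => zero_mem _⟩
      one_mem' := ⟨0, fun i _ => one_mem _⟩
      add_mem' := fun {a b} ⟨j, hj⟩ ⟨l, hl⟩ =>
        ⟨max j l, fun i hi => add_mem (hj i (by lia)) (hl i (by lia))⟩
      mul_mem' := fun {a b} ⟨j, hj⟩ ⟨l, hl⟩ =>
        ⟨max j l, fun i hi => mul_mem (hj i (by lia)) (hl i (by lia))⟩
      neg_mem' := fun {a} ⟨j, hj⟩ => ⟨j, fun i hi => neg_mem (hj i hi)⟩
      mem_or_inv_mem' := fun a => by
        obtain ⟨m, hm⟩ := exists_mem_KAt htop a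
        have hm' : a ∈ KAt k₀ x (n + m) := gen_mono (KSet_mono (by lia)) hm
        exact ((w m).mem_or_inv_mem a).imp (fun h => ⟨m, hstab' m a hm' h⟩)
          fun h => ⟨m, hstab' m _ (inv_mem hm') h⟩ }
  have hmem : ∀ j, ∀ a ∈ KAt k₀ x (n + j), a ∈ w j → a ∈ W := fun j a ha haj =>
    ⟨j, hstab' j a ha haj⟩
  refine ⟨W, fun a ha => ?_, fun a ha => ⟨?_, hmem 0 a ha⟩, fun m hm => ?_⟩
  · obtain ⟨m, hm⟩ := mem_DUnion.1 ha
    have hm' : a ∈ DAt k₀ x (n + m) := DAt_mono (by lia) hm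
    exact hmem m a (DAt_le_KAt _ hm') (hwD m hm')
  · rintro ⟨j, hj⟩
    rw [← show w 0 = W₀ from rfl, ← hstab 0 j a ha, zero_add]
    exact hj j le_rfl
  · obtain ⟨j, rfl⟩ := Nat.exists_eq_add_of_le hm
    exact hmem (j + 1) _ (tAt_mem_KAt hx _) (hgt (n + j) (w j))

theorem isFractionRing_DUnion (htop : gen k₀ x Set.univ = ⊤) : IsFractionRing (DUnion k₀ x) L := by
  refine .of_field _ _ fun z => ?_
  obtain ⟨n, hn⟩ := exists_mem_KAt htop z
  obtain ⟨b, hb, c, hc, -, h⟩ := (exists_fraction hx n).1 z hn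
  exact ⟨⟨b, DAt_le_DUnion n hb⟩, ⟨c, DAt_le_DUnion n hc⟩, h⟩

theorem isEssential_DUnion (htop : gen k₀ x Set.univ = ⊤) : IsEssential (DUnion k₀ x) := by
  have := isFractionRing_DUnion hx htop
  refine isEssential_of_isFractional fun a ha => ?_
  obtain ⟨n, hn⟩ := exists_mem_KAt htop a
  obtain ⟨W₀, hW₀, haW₀⟩ := exists_valuationSubring_of_notMem_DAt hx hn
    fun h => ha (DAt_le_DUnion n h)
  obtain ⟨W, hDW, hW, ht⟩ := exists_gauss_tower hx htop hW₀
  exact ⟨W, hDW, isFractional_of_tAt_mem hx htop hDW ht, fun h => haW₀ ((hW a hn).1 h)⟩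

/-! ### The dimension of `D` -/

omit hx in
theorem valuation_lt_one_iff_inv_notMem (W : ValuationSubring L) {a : L} :
    W.valuation a < 1 ↔ a = 0 ∨ a⁻¹ ∉ W := by
  rw [← ValuationSubring.mem_nonunits_iff, ← inv_inv a, ValuationSubring.inv_mem_nonunits_iff,
    inv_inv, inv_eq_zero]

/-- There is a valuation ring containing `k₀(X₀)` in which each of `Z₀, …, Z_{i-1}` is infinitely
small compared to the field generated by the preceding ones. -/
theorem exists_composite_Z (i : ℕ) (hi : i ≤ r - 1) :
    ∃ W : ValuationSubring L, (∀ c ∈ kAt k₀ x 0, c ∈ W) ∧ ∀ j : Fin (r - 1), (j : ℕ) < i →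
      ∀ e ∈ gen k₀ x (kSet r 0 ∪ Indet.Z '' {l | l < j}), W.valuation (e * x (.Z j)) < 1 := by
  induction i with
  | zero => exact ⟨⊤, fun c _ => ValuationSubring.mem_top c, fun j hj => absurd hj (by lia)⟩
  | succ i ih =>
    obtain ⟨W₀, hk, hW₀⟩ := ih (by lia)
    let i' : Fin (r - 1) := ⟨i, by lia⟩
    have hZ : Indet.Z i' ∉ kSet r 0 ∪ Indet.Z '' {l | l < i'} := by
      rintro (⟨j, -, h⟩ | ⟨j, hj, h⟩)
      · cases h
      · cases h
        exact lt_irrefl i' hj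
    set F := gen k₀ x (kSet r 0 ∪ Indet.Z '' {l | l < i'})
    obtain ⟨W, hW, hWZ⟩ := exists_composite (W₀.comap (algebraMap F L)) (transcendental_gen hx hZ)
    have hW' : ∀ a ∈ F, a ∈ W ↔ a ∈ W₀ := fun a ha => hW ⟨a, ha⟩
    refine ⟨W, fun c hc => (hW' c ?_).2 (hk c hc), fun j hj e he => ?_⟩
    · rw [kAt_eq] at hc
      exact gen_mono Set.subset_union_left hc
    · rcases (Nat.lt_succ_iff_lt_or_eq.1 hj) with hj | hj
      · have hjF : e * x (.Z j) ∈ F :=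
          mul_mem (gen_mono (Set.union_subset_union_right _ (Set.image_mono fun l hl =>
            lt_trans hl (Fin.lt_def.2 hj))) he) (mem_gen (Or.inr ⟨j, Fin.lt_def.2 hj, rfl⟩))
        have h1 := hW₀ j hj e he
        rw [valuation_lt_one_iff_inv_notMem] at h1 ⊢
        rwa [hW' _ (inv_mem hjF)]
      · obtain rfl : j = i' := Fin.ext hj
        exact hWZ ⟨e, he⟩

/-- A tower of Gauss extensions above the composite of the places of `Z₀, …, Z_{r-2}, Y` is a
localization of `D` of dimension at least `r`. -/
theorem exists_isFractional_le_ringKrullDim (htop : gen k₀ x Set.univ = ⊤) (hr : 2 ≤ r) :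
    ∃ W : ValuationSubring L, DUnion k₀ x ≤ W.toSubring ∧ IsFractional (DUnion k₀ x) W ∧
      r ≤ ringKrullDim W := by
  obtain ⟨W₁, hk, hZ₁⟩ := exists_composite_Z hx (r - 1) le_rfl
  obtain ⟨W₂, hW₂, hY₂⟩ := exists_composite_VAt hx 0 (W₁.comap (algebraMap (FAt k₀ x 0) L))
  have hW₂' : ∀ a ∈ FAt k₀ x 0, a ∈ W₂ ↔ a ∈ W₁ := fun a ha => hW₂ ⟨a, ha⟩
  have hA : DAt k₀ x 0 ≤ W₂.toSubring := by
    rintro _ ⟨c, hc, v, hv, rfl⟩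
    exact add_mem ((hW₂' c (kAt_le_FAt 0 hc)).2 (hk c hc))
      ((W₂.valuation_le_one_iff _).1 (hY₂ v hv).le)
  obtain ⟨W, hDW, hW, ht⟩ := exists_gauss_tower hx htop hA
  refine ⟨W, hDW, isFractional_of_tAt_mem hx htop hDW ht, ?_⟩
  have hlt : ∀ a ∈ KAt k₀ x 0, W₂.valuation a < 1 → W.valuation a < 1 := by
    intro a ha h
    rw [valuation_lt_one_iff_inv_notMem] at h ⊢
    rwa [hW _ (inv_mem ha)]
  have hlt' : ∀ a ∈ FAt k₀ x 0, W₁.valuation a < 1 → W.valuation a < 1 := by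
    intro a ha h
    refine hlt a (FAt_le_KAt 0 ha) ?_
    rw [valuation_lt_one_iff_inv_notMem] at h ⊢
    rwa [hW₂' _ (inv_mem ha)]
  have hne : ∀ i, x i ≠ 0 := fun i h => hx.ne_zero i h
  have hZF : ∀ i, x (.Z i) ∈ FAt k₀ x 0 := fun i => by
    rw [FAt_eq]
    exact mem_gen (Or.inr ⟨i, rfl⟩)
  have hle : ∀ (a b : L) (n : ℕ), b ≠ 0 → W.valuation ((b ^ n)⁻¹ * a) < 1 →
      W.valuation a ≤ W.valuation b ^ n := by
    intro a b n hb h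
    have h1 : a = b ^ n * ((b ^ n)⁻¹ * a) := by
      rw [mul_inv_cancel_left₀ (pow_ne_zero _ hb)]
    conv_lhs => rw [h1, map_mul, map_pow]
    exact mul_le_of_le_one_right' h.le
  -- a chain of infinitely small elements: `0`, `Y`, `Z_{r-2}`, …, `Z₀`
  let z : ℕ → L := fun i => match i with
    | 0 => 0
    | 1 => x .Y
    | i + 2 => x (.Z ⟨r - 2 - i, by lia⟩)
  refine natCast_le_ringKrullDim (fun i => z i) (fun i => ?_) fun i j hij => ?_
  · rcases i with ⟨_ | _ | i, hi⟩
    · change W.valuation 0 < 1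
      simp
    · exact hlt _ (Y_mem_KAt 0) (by simpa using hY₂ 1 (one_mem _))
    · exact hlt' _ (hZF _) (by simpa using hZ₁ ⟨r - 2 - i, by lia⟩ (by simp; lia) 1 (one_mem _))
  · rcases j with ⟨_ | _ | j, hj⟩
    · exact absurd (Fin.lt_def.1 hij) (by simp)
    · refine ⟨hne .Y, fun n => ?_⟩
      rcases i with ⟨_ | i, hi⟩
      · change W.valuation 0 ≤ _
        simp
      · exact absurd (Fin.lt_def.1 hij) (by simp)
    · refine ⟨hne (.Z _), fun n => ?_⟩
      rcases i with ⟨_ | _ | i, hi⟩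
      · change W.valuation 0 ≤ _
        simp
      · refine hle _ _ n (hne (.Z _)) (hlt _ ?_ ?_)
        · exact mul_mem (FAt_le_KAt 0 (inv_mem (pow_mem (hZF _) n))) (Y_mem_KAt 0)
        · rw [mul_comm]
          exact hY₂ _ (mem_VAt_of_mem_FAt (inv_mem (pow_mem (hZF _) n)))
      · have hij' : i < j := by simpa using Fin.lt_def.1 hij
        refine hle _ _ n (hne (.Z _)) (hlt' _ ?_ ?_)
        · exact mul_mem (inv_mem (pow_mem (hZF _) n)) (hZF _)
        · refine hZ₁ ⟨r - 2 - i, by lia⟩ (by simp; lia) _ (inv_mem (pow_mem (mem_gen ?_) n))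
          exact Or.inr ⟨_, Fin.lt_def.2 (by simp; lia), rfl⟩

variable (htop : gen k₀ x Set.univ = ⊤)

include htop

/-- The localization of `D` at the trace of a prime of `D[T₁, …, T_N]` is a valuation ring, or the
trace is contained in the prime at which the localization of `D` is `A`. -/
theorem ringKrullDim_mvPolynomial_DUnion_le (hr : 1 ≤ r) (N : ℕ) :
    ringKrullDim (MvPolynomial (Fin N) (DUnion k₀ x)) ≤ N + r := by
  rw [ringKrullDim_le_iff_height_le]
  intro P hP
  by_cases h : ∃ d ∈ P.comap MvPolynomial.C, ∀ n, ∀ v ∈ VAt k₀ x n, (d : L) ≠ x .Y * v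
  · obtain ⟨d, hd, hd'⟩ := h
    obtain ⟨W, hDW, hW, hc⟩ := exists_center_eq_of_mem hx htop hd hd'
    let := (toValuationSubring hDW).toAlgebra
    have := hW.isLocalization hDW
    calc (P.height : WithBot ℕ∞) ≤ ringKrullDim (MvPolynomial (Fin N) W) :=
          height_le_ringKrullDim_mvPolynomial P (center hDW) hc.ge
      _ ≤ N + ringKrullDim W := ringKrullDim_mvPolynomial_le_of_valuationRing N
      _ ≤ N + r := add_le_add_right (ringKrullDim_le_of_DUnion_le hx htop hr hDW) _
  · push Not at h
    let := (Subring.inclusion (DUnion_le_AUnion (k₀ := k₀) (x := x))).toAlgebra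
    have := isPrime_idealY hx
    have := isLocalization_AUnion hx
    let := ((algebraMap (kUnion k₀ x) L).codRestrict (AUnion k₀ x)
      fun a => kUnion_le_AUnion a.2).toAlgebra
    have : IsScalarTower (kUnion k₀ x) (AUnion k₀ x) L := .of_algebraMap_eq fun _ => rfl
    refine (height_le_ringKrullDim_mvPolynomial (B := AUnion k₀ x) P (idealY k₀ x)
      fun d hd => h d hd).trans ?_
    refine ringKrullDim_mvPolynomial_le_of_trdeg_le (κ := kUnion k₀ x) (L := L)
      Subtype.val_injective ?_ N
    refine (trdeg_le_card (x := x) (YZFinset r) (mem_adjoin_kUnion htop)).trans ?_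
    exact_mod_cast card_YZFinset_le hr

theorem ringKrullDim_DUnion (hr : 2 ≤ r) : ringKrullDim (DUnion k₀ x) = r := by
  apply le_antisymm
  · have h := ringKrullDim_mvPolynomial_DUnion_le hx htop (by lia) 0
    rwa [ringKrullDim_mvPolynomial_of_isEmpty, Nat.cast_zero, zero_add] at h
  · obtain ⟨W, hDW, hW, h⟩ := exists_isFractional_le_ringKrullDim hx htop hr
    exact h.trans (hW.ringKrullDim_le hDW)

theorem isJaffard_DUnion (hr : 2 ≤ r) : IsJaffard (DUnion k₀ x) := by
  refine ⟨?_, fun n _ => le_antisymm ?_ ?_⟩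
  · rw [ringKrullDim_DUnion hx htop hr]
    exact WithBot.coe_lt_coe.2 (ENat.natCast_lt_top r)
  · rw [ringKrullDim_DUnion hx htop hr]
    exact ringKrullDim_mvPolynomial_DUnion_le hx htop (by lia) n
  · have h := ringKrullDim_add_natCard_le_ringKrullDim_mvPolynomial (R := DUnion k₀ x) (Fin n)
    rwa [Nat.card_fin, add_comm] at h

theorem valuativeDim_DUnion (hr : 2 ≤ r) : valuativeDim (DUnion k₀ x) = r := by
  have := isFractionRing_DUnion hx htop
  rw [valuativeDim_eq (L := L)]
  apply le_antisymm
  · exact iSup_le fun W => ringKrullDim_le_of_DUnion_le hx htop (by lia) W.2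
  · obtain ⟨W, hDW, -, h⟩ := exists_isFractional_le_ringKrullDim hx htop hr
    exact h.trans (le_iSup (fun W : {W : ValuationSubring L // DUnion k₀ x ≤ W.toSubring} =>
      ringKrullDim W.1) ⟨W, hDW⟩)

end Tower

/-! ### The indeterminates in the rational function field -/

theorem algebraicIndependent_indet (k₀ : Type*) [Field k₀] (r : ℕ) :
    AlgebraicIndependent k₀ (indet k₀ r) := by
  have h := (MvPolynomial.algebraicIndependent_X (Indet r) k₀).map'
    (f := IsScalarTower.toAlgHom k₀ (MvPolynomial (Indet r) k₀) (RatField k₀ r))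
    (IsFractionRing.injective _ _)
  exact h

theorem gen_indet_univ (k₀ : Type*) [Field k₀] (r : ℕ) : gen k₀ (indet k₀ r) Set.univ = ⊤ := by
  rw [eq_top_iff]
  intro a _
  have h : ∀ p : MvPolynomial (Indet r) k₀,
      algebraMap _ (RatField k₀ r) p ∈ gen k₀ (indet k₀ r) Set.univ := by
    intro p
    induction p using MvPolynomial.induction_on with
    | C c =>
      rw [← MvPolynomial.algebraMap_eq, ← IsScalarTower.algebraMap_apply]
      exact IntermediateField.algebraMap_mem _ c
    | add p q hp hq =>
      rw [map_add]
      exact add_mem hp hq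
    | mul_X p i hp =>
      rw [map_mul]
      exact mul_mem hp (mem_gen (Set.mem_univ i))
  obtain ⟨p, q, -, rfl⟩ := IsFractionRing.div_surjective (A := MvPolynomial (Indet r) k₀) a
  exact div_mem (h p) (h q)

end EssentialDomains

end

theorem mainTheorem3 (k₀ : Type*) [Field k₀] (r : ℕ) (hr : 2 ≤ r) :
    Monotone (EssentialDomains.essD k₀ r) ∧
    ∃ D : Subring (EssentialDomains.RatField k₀ r),
      (D : Set (EssentialDomains.RatField k₀ r)) = ⋃ n, EssentialDomains.essD k₀ r n ∧
      EssentialDomains.IsEssential D ∧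
      ¬ EssentialDomains.IsLocallyEssential D ∧
      EssentialDomains.IsJaffard D ∧
      ringKrullDim D = r ∧
      EssentialDomains.valuativeDim D = r := by
  have hx := EssentialDomains.algebraicIndependent_indet k₀ r
  have htop := EssentialDomains.gen_indet_univ k₀ r
  refine ⟨EssentialDomains.DAt_mono (x := EssentialDomains.indet k₀ r),
    EssentialDomains.DUnion k₀ (EssentialDomains.indet k₀ r), ?_,
    EssentialDomains.isEssential_DUnion hx htop,
    EssentialDomains.not_isLocallyEssential hx htop hr,
    EssentialDomains.isJaffard_DUnion hx htop hr,
    EssentialDomains.ringKrullDim_DUnion hx htop hr,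
    EssentialDomains.valuativeDim_DUnion hx htop hr⟩
  ext a
  rw [SetLike.mem_coe, EssentialDomains.mem_DUnion, Set.mem_iUnion]
  rfl
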